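/- In graph take-away on a finite graph, two players alternately delete either one edge or one vertex together with all its incident edges; a player who cannot move loses. The nim-value $g(G)$ is defined recursively as the least non-negative integer that is not the nim-value of a graph obtained from $G$ by one move. Put $\varphi(G)=(|V(G)| \bmod 2)+2\,(|E(G)|\bmod 2)$. Say that $G$ has a cancellation at a vertex $s$, with result $G'$, if $s\in V(G')$ and $G$ is obtained from disjoint graphs $G',H_1,H_2$, where there is an isomorphism $H_1\to H_2$ taking a vertex $v_1$ to a vertex $v_2$, by adding the two edges $sv_1$ and $sv_2$. A graph is reduced if it has no cancellation; to reduce a graph is to perform cancellations successively until none is possible. If a graph has exactly one cycle and this cycle is odd, and $T$ is the tree attached to the cycle at its vertex $A$ (so that $T$ meets the cycle in $A$ only), then a vertex $t$ of $T$ is called telescoping if, after $t$ is deleted and the resulting graph is reduced, $A$ is the only remaining vertex of $T$ that is still connected to the cycle. Let $G$ be a finite, reduced, possibly disconnected graph that contains exactly one odd cycle and no other cycles (a pair of parallel edges counting as a cycle of length $2$) and no loops. Then $g(G)\neq\varphi(G)$ if and only if one of the following conditions holds: (i) all vertices of the cycle have degree $2$; (ii) exactly one vertex of the cycle has degree greater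 than $2$, and there is a telescoping vertex of odd degree (degree taken in $G$). -/

import Mathlib

/-! Graph take-away on a finite graph.  Every graph in which all cycles (a loop being a cycle of
length one, a pair of parallel edges giving a cycle of length two) have length at least three is
simple, and deletions keep it so; hence graphs are modelled by `SimpleGraph`.  All positions
reached from a starting graph `G` are subgraphs of `G`, with their own vertex and edge sets. -/

namespace GraphTakeaway

variable {V : Type*} {G : SimpleGraph V}

/-- `K` is obtained from the position `H` by one move: deleting a vertex of `H` together with all
incident edges, or deleting an edge of `H`. -/
def IsMove (H K : G.Subgraph) : Prop :=
  (∃ v ∈ H.verts, K = H.deleteVerts {v}) ∨ (∃ e ∈ H.edgeSet, K = H.deleteEdges {e})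

theorem IsMove.lt {H K : G.Subgraph} (h : IsMove H K) : K < H := by
  rcases h with ⟨v, hv, rfl⟩ | ⟨e, he, rfl⟩
  · refine lt_of_le_of_ne SimpleGraph.Subgraph.deleteVerts_le fun h => ?_
    have : v ∈ (H.deleteVerts {v}).verts := by rw [h]; exact hv
    simp at this
  · refine lt_of_le_of_ne (SimpleGraph.Subgraph.deleteEdges_le _) fun h => ?_
    have : e ∈ (H.deleteEdges {e}).edgeSet := by rw [h]; exact he
    induction e with
    | _ x y => simp at this

/-- The nim-value (Sprague-Grundy value) of the position `H`: the least natural number that is not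
the nim-value of a position reachable from `H` in one move. -/
noncomputable def nimValue [Finite V] (H : G.Subgraph) : ℕ :=
  sInf {n : ℕ | ∀ K : G.Subgraph, ∀ _ : IsMove H K, nimValue K ≠ n}
termination_by (wellFounded_lt (α := G.Subgraph)).wrap H
decreasing_by exact IsMove.lt ‹_›

/-- The parity function: number of vertices mod 2, plus twice the number of edges mod 2. -/
noncomputable def phi (H : G.Subgraph) : ℕ :=
  H.verts.ncard % 2 + 2 * (H.edgeSet.ncard % 2)

/-- `H` has cancellation at `s`, with result `K`.  The vertex set of `H` splits as the disjoint
union of `S₁`, `S₂` and the vertex set of `K`, which contains `s`.  There is an isomorphism between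
the subgraphs of `H` on `S₁` and on `S₂` that takes `v₁` to `v₂`, and the only edges of `H` that
join two different parts are `s v₁` and `s v₂`. -/
def CancelsAt (H : G.Subgraph) (s : V) (K : G.Subgraph) : Prop :=
  ∃ (S₁ S₂ : Set V) (v₁ : S₁) (v₂ : S₂),
    S₁ ⊆ H.verts ∧ S₂ ⊆ H.verts ∧ Disjoint S₁ S₂ ∧
    s ∈ H.verts ∧ s ∉ S₁ ∧ s ∉ S₂ ∧
    H.Adj s v₁ ∧ H.Adj s v₂ ∧
    (∀ x ∈ S₁, ∀ y ∉ S₁, H.Adj x y → x = v₁ ∧ y = s) ∧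
    (∀ x ∈ S₂, ∀ y ∉ S₂, H.Adj x y → x = v₂ ∧ y = s) ∧
    (∃ f : S₁ ≃ S₂, f v₁ = v₂ ∧ ∀ x y : S₁, H.Adj (f x) (f y) ↔ H.Adj x y) ∧
    K = H.deleteVerts (S₁ ∪ S₂)

/-- A graph is reduced if no cancellation is possible. -/
def IsReduced (H : G.Subgraph) : Prop :=
  ¬ ∃ (s : V) (K : G.Subgraph), CancelsAt H s K

/-- `K` is a result of reducing `H`: it is reached from `H` by successive cancellations and no
further cancellation is possible. -/
def ReducesTo (H K : G.Subgraph) : Prop :=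
  Relation.ReflTransGen (fun H₁ H₂ : G.Subgraph => ∃ s : V, CancelsAt H₁ s H₂) H K ∧ IsReduced K

/-- The vertex set (including `A`) of the tree attached to the cycle `C` at its vertex `A`, in a
graph with no cycle other than `C`: the vertices connected to `A` without use of edges of `C`. -/
def attachedTree {u : V} (C : G.Walk u u) (A : V) : Set V :=
  {v | (G.deleteEdges {e | e ∈ C.edges}).Reachable A v}

/-- The vertex `t` of the tree attached to the cycle `C` at `A` is telescoping: when `t` is deleted
from the graph and the resulting graph is reduced, the only remaining vertex of that tree that is
still connected to the cycle is `A`. -/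
def IsTelescoping {u : V} (C : G.Walk u u) (A t : V) : Prop :=
  t ∈ attachedTree C A ∧
  ∃ K : G.Subgraph, ReducesTo ((⊤ : G.Subgraph).deleteVerts {t}) K ∧
    {v | v ∈ attachedTree C A ∧ v ∈ K.verts ∧ ∃ c ∈ C.support, K.spanningCoe.Reachable c v} = {A}

end GraphTakeaway

namespace GraphTakeaway

/-! ### Codes of rooted trees

A rooted tree without cancellation is a hereditarily finite set.  Such sets are encoded by finitely
supported functions `ℕ →₀ ZMod 2`, so that cancellation becomes addition modulo two. -/

/-! Read `phi` as two bits. Deleting an edge flips the edge bit, a vertex of even degree the vertex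
bit, a vertex of odd degree both. So no move preserves `phi`, and a bipartite graph has enough
vertices of the required degree parities for nim-value `phi` (`nimValue_eq_phi_of_colorable`). This
settles all positions in which the odd cycle is broken.

If the cycle survives, root the forest off the cycle at the cycle vertices. Up to cancellation a
rooted tree is a hereditarily finite set, and cancelling equal siblings is addition modulo two of
characteristic vectors. The numbers of children and of edges modulo two are additive, so they can be
read off the code. Deleting an off-cycle vertex of odd degree changes one attached code at most, by
a `Bad` code (`exists_change`); conversely every `Mv` is realised by such a deletion
(`exists_below_of_mv`). A code can be annihilated this way exactly when it is bad (`Mv.bad`,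
`Bad.mv_self`).

Induction over positions (`described`) yields three kinds: all attached codes zero, with value `3 -
phi` (both bits flipped); one bad code and the others zero, with value at least 4; all else, with
value `phi`. Deletions of odd degree link the first two kinds, which is why the exceptional values
are consistent. The core is to find moves that avoid zero and bad codes (`Bad.exists_mv`,
`exists_mv_not_bad`): a set of two children `y`, `z` is bad exactly when the smaller set `y + z` is.

In a reduced graph an attached code vanishes only if there is no tree
(`code_eq_zero_iff_of_isReduced`), and cancellation preserves the codes on the cycle
(`code_of_cancelsAt`); so a vertex is telescoping when its deletion makes the code at `A` zero. -/

/-- Hereditarily finite sets, as finite sets of codes of their elements. -/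
abbrev Code := ℕ →₀ ZMod 2

/-- The Ackermann numbering of codes. -/
noncomputable def enc (x : Code) : ℕ := ∑ i ∈ x.support, 2 ^ i

theorem Code.add_self (x : Code) : x + x = 0 := ZModModule.add_self x

theorem Code.apply_eq_one {x : Code} {i : ℕ} (h : x i ≠ 0) : x i = 1 := by
  generalize x i = a at h
  revert a; decide

theorem enc_injective : Function.Injective enc := by
  intro x y h
  have hs : x.support = y.support := Finset.geomSum_injective le_rfl h
  ext1 i
  by_cases hi : x i = 0
  · have : i ∉ y.support := by rw [← hs]; simpa using hi
    rw [hi]; exact (by simpa using this : y i = 0).symm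
  · have : i ∈ y.support := by rw [← hs]; simpa using hi
    rw [Code.apply_eq_one hi, Code.apply_eq_one (by simpa using this)]

theorem enc_surjective : Function.Surjective enc := by
  intro n
  refine ⟨Finsupp.indicator (Finset.equivBitIndices n) fun _ _ => 1, ?_⟩
  have hs : (Finsupp.indicator (Finset.equivBitIndices n) fun _ _ => (1 : ZMod 2)).support
      = Finset.equivBitIndices n := by
    ext i; simp
  rw [enc, hs]
  exact Finset.equivBitIndices.symm_apply_apply n

/-- Addition modulo two is exclusive or on binary digits, which never exceeds the sum. -/
theorem enc_add_le (x y : Code) : enc (x + y) ≤ enc x + enc y := by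
  classical
  calc enc (x + y) ≤ ∑ i ∈ x.support ∪ y.support, 2 ^ i :=
        Finset.sum_le_sum_of_subset Finsupp.support_add
    _ ≤ ∑ i ∈ x.support ∪ y.support, 2 ^ i + ∑ i ∈ x.support ∩ y.support, 2 ^ i :=
        Nat.le_add_right _ _
    _ = enc x + enc y := Finset.sum_union_inter

/-- The singleton `{y}`. -/
noncomputable def sing (y : Code) : Code := Finsupp.single (enc y) 1

theorem sing_apply_self (y : Code) : sing y (enc y) = 1 := by simp [sing]

theorem sing_apply_of_ne {y z : Code} (h : y ≠ z) : sing y (enc z) = 0 := by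
  rw [sing, Finsupp.single_apply, if_neg (fun h' => h (enc_injective h'))]

theorem sing_injective : Function.Injective sing := by
  intro y z h
  by_contra hne
  have := sing_apply_of_ne hne
  rw [h, sing_apply_self] at this
  exact one_ne_zero this

theorem enc_sing (y : Code) : enc (sing y) = 2 ^ enc y := by
  simp [enc, sing]

theorem sing_ne_zero (y : Code) : sing y ≠ 0 := by simp [sing]

theorem exists_mem_of_ne_zero {x : Code} (h : x ≠ 0) : ∃ y, x (enc y) ≠ 0 := by
  obtain ⟨i, hi⟩ := Finsupp.ne_iff.1 h
  obtain ⟨y, rfl⟩ := enc_surjective i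
  exact ⟨y, hi⟩

theorem enc_add_sing {x y : Code} (h : x (enc y) ≠ 0) : enc (x + sing y) + 2 ^ enc y = enc x := by
  classical
  have hs : (x + sing y).support = x.support.erase (enc y) := by
    ext i
    rcases eq_or_ne i (enc y) with rfl | hi
    · simp [sing_apply_self, Code.apply_eq_one h]
      decide
    · simp [sing, hi]
  have he : enc (x + sing y) = ∑ i ∈ x.support.erase (enc y), 2 ^ i := by rw [← hs]; rfl
  rw [he]
  exact Finset.sum_erase_add _ _ (Finsupp.mem_support_iff.2 h)

/-- Since `n < 2 ^ n`, an element has a smaller number than its set; this permits induction on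
`enc`. -/
theorem enc_lt_of_mem {x y : Code} (h : x (enc y) ≠ 0) : enc y < enc x := by
  have := enc_add_sing h
  have := Nat.lt_two_pow_self (n := enc y)
  omega

/-- The number of elements modulo two. -/
noncomputable def par : Code →+ ZMod 2 := Finsupp.liftAddHom fun _ => AddMonoidHom.id (ZMod 2)

@[simp] theorem par_sing (y : Code) : par (sing y) = 1 := by simp [par, sing]

/-- The number of edges of the tree with a given code number, modulo two. -/
noncomputable def edgeParityNum (n : ℕ) : ZMod 2 :=
  -- The elements of the set numbered `n` have numbers below `n`, so the range misses none of them.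
  ∑ i ∈ (Finset.range n).attach,
    if (Function.surjInv enc_surjective n) i = 0 then 0 else 1 + edgeParityNum i
decreasing_by exact Finset.mem_range.1 i.2

/-- The number of edges of the tree with a given code, modulo two. -/
noncomputable def edgeParity : Code →+ ZMod 2 :=
  Finsupp.liftAddHom fun i => AddMonoidHom.mulRight (1 + edgeParityNum i)

theorem edgeParityNum_enc (x : Code) : edgeParityNum (enc x) = edgeParity x := by
  have hx : Function.surjInv enc_surjective (enc x) = x :=
    enc_injective (Function.surjInv_eq enc_surjective _)
  rw [edgeParityNum, hx, Finset.sum_attach (Finset.range (enc x))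
    (fun i => if x i = 0 then 0 else 1 + edgeParityNum i)]
  rw [edgeParity, Finsupp.liftAddHom_apply, Finsupp.sum, ← Finset.sum_subset (s₁ := x.support)]
  · refine Finset.sum_congr rfl fun i hi => ?_
    have hi : x i ≠ 0 := by simpa using hi
    simp [Code.apply_eq_one hi]
  · intro i hi
    obtain ⟨y, rfl⟩ := enc_surjective i
    exact Finset.mem_range.2 (enc_lt_of_mem (by simpa using hi))
  · intro i _ hi
    have : x i = 0 := by simpa using hi
    simp [this]

@[simp] theorem edgeParity_sing (y : Code) : edgeParity (sing y) = 1 + edgeParity y := by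
  rw [← edgeParityNum_enc y]
  simp [edgeParity, sing]

/-! ### Moves on codes and bad codes -/

/-- `Mv x b`: deleting some vertex of odd degree, other than the root, from the tree with code `x`
changes the code to `x + b`.  The edge from a subtree to its parent counts for the degree. -/
inductive Mv : Code → Code → Prop
  | child (x y : Code) : x (enc y) ≠ 0 → par y = 0 → Mv x (sing y)
  | deep (x y b : Code) : x (enc y) ≠ 0 → Mv y b → Mv x (sing y + sing (y + b))

/-- Codes of trees that become trivial when a suitable vertex of odd degree is deleted. -/
inductive Bad : Code → Prop
  | one (y : Code) : par y = 0 → Bad (sing y)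
  | two (y z : Code) : Bad (y + z) → Bad (sing y + sing z)

theorem Code.add_add_cancel (x y : Code) : x + (x + y) = y := by
  rw [← add_assoc, Code.add_self, zero_add]

theorem Code.add_eq_zero {x y : Code} : x + y = 0 ↔ x = y := by
  constructor
  · intro h
    have := Code.add_add_cancel x y
    rw [h, add_zero] at this
    exact this
  · rintro rfl; exact Code.add_self x

theorem add_sing_apply_left {y z : Code} (h : y ≠ z) : (sing y + sing z) (enc y) ≠ 0 := by
  rw [Finsupp.add_apply, sing_apply_self, sing_apply_of_ne h.symm]
  decide

theorem add_sing_apply_right {y z : Code} (h : y ≠ z) : (sing y + sing z) (enc z) ≠ 0 := by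
  rw [add_comm]; exact add_sing_apply_left h.symm

theorem Bad.ne_zero {x : Code} (h : Bad x) : x ≠ 0 := by
  induction h with
  | one y _ => exact sing_ne_zero y
  | two y z _ ih =>
    intro h0
    exact ih (Code.add_eq_zero.2 (sing_injective (Code.add_eq_zero.1 h0)))

/-- As `y + (y + b) = b`, the recursion of `Mv` on the change is that of `Bad`. -/
theorem Mv.bad {x b : Code} (h : Mv x b) : Bad b := by
  induction h with
  | child x y _ hy => exact .one y hy
  | deep x y b _ _ ih => exact .two _ _ (by rwa [Code.add_add_cancel])

/-- An element of a symmetric difference lies in one of the two sets, and a move only involves the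
element in which it takes place. -/
theorem Mv.of_add {y z b : Code} (h : Mv (y + z) b) : Mv y b ∨ Mv z b := by
  have key : ∀ w : Code, (y + z) (enc w) ≠ 0 → y (enc w) ≠ 0 ∨ z (enc w) ≠ 0 := by
    intro w hw
    by_contra! hc
    simp [hc.1, hc.2] at hw
  cases h with
  | child _ w hw hp => exact (key w hw).imp (Mv.child _ _ · hp) (Mv.child _ _ · hp)
  | deep _ w b hw hb => exact (key w hw).imp (Mv.deep _ _ _ · hb) (Mv.deep _ _ _ · hb)

/-- Bad codes can be annihilated. For a pair, the move that annihilates `y + z` takes place inside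
`y` or `z` and makes the two equal, so that they cancel. -/
theorem Bad.mv_self {x : Code} (h : Bad x) : Mv x x := by
  induction h with
  | one y hy => exact .child _ _ (by rw [sing_apply_self]; decide) hy
  | two y z h ih =>
    have hne : y ≠ z := fun e => h.ne_zero (Code.add_eq_zero.2 e)
    rcases ih.of_add with h' | h'
    · have := Mv.deep (sing y + sing z) y _ (add_sing_apply_left hne) h'
      rwa [Code.add_add_cancel] at this
    · have := Mv.deep (sing y + sing z) z _ (add_sing_apply_right hne) h'
      rwa [add_comm y z, Code.add_add_cancel, add_comm (sing z)] at this

theorem sing_pair_eq {y z c d : Code} (hyz : y ≠ z) (h : sing y + sing z = sing c + sing d) :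
    (y = c ∧ z = d) ∨ (y = d ∧ z = c) := by
  have hy := add_sing_apply_left hyz
  have hz := add_sing_apply_right hyz
  rw [h] at hy hz
  have key : ∀ w : Code, (sing c + sing d) (enc w) ≠ 0 → w = c ∨ w = d := by
    intro w hw
    by_contra! hc
    rw [Finsupp.add_apply, sing_apply_of_ne hc.1.symm, sing_apply_of_ne hc.2.symm] at hw
    simp at hw
  rcases key y hy with h1 | h1 <;> rcases key z hz with h2 | h2
  · exact absurd (h1.trans h2.symm) hyz
  · exact .inl ⟨h1, h2⟩
  · exact .inr ⟨h1, h2⟩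
  · exact absurd (h1.trans h2.symm) hyz

/-- The parity of the number of elements rules out the constructor `one`, and the elements of a
two-element set are determined up to order. -/
theorem bad_pair_iff {y z : Code} (hyz : y ≠ z) : Bad (sing y + sing z) ↔ Bad (y + z) := by
  refine ⟨fun h => ?_, .two y z⟩
  generalize hx : sing y + sing z = x at h
  cases h with
  | one w _ =>
    have := congrArg par hx
    simp only [map_add, par_sing] at this
    exact absurd this (by decide)
  | two c d h =>
    rcases sing_pair_eq hyz hx with ⟨rfl, rfl⟩ | ⟨rfl, rfl⟩
    · exact h
    · rwa [add_comm]

theorem bad_sing_iff {y : Code} : Bad (sing y) ↔ par y = 0 := by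
  refine ⟨fun h => ?_, .one y⟩
  generalize hx : sing y = x at h
  cases h with
  | one w h => exact sing_injective hx ▸ h
  | two c d h =>
    have := congrArg par hx
    simp only [map_add, par_sing] at this
    exact absurd this (by decide)

theorem add_sing_pair (y z w : Code) : sing y + sing z + (sing y + w) = sing z + w := by
  rw [add_comm (sing y), add_assoc, Code.add_add_cancel]

/-- A move in `y + z` to a non-bad nonzero code gives such a move in `{y, z}`. -/
theorem exists_mv_pair {y z b : Code} (hyz : y ≠ z) (hb : Mv (y + z) b) (hnb : ¬ Bad (y + z + b))
    (h0 : y + z + b ≠ 0) :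
    ∃ b, Mv (sing y + sing z) b ∧ sing y + sing z + b ≠ 0 ∧ ¬ Bad (sing y + sing z + b) := by
  rcases hb.of_add with h | h
  -- The modified child must not cancel against the other one; it would only do so if `y + z + b`
  -- were zero.
  · have hne : z ≠ y + b := fun e => h0 (by
      rw [e, ← add_assoc, Code.add_self, zero_add, Code.add_self])
    refine ⟨_, .deep _ y b (add_sing_apply_left hyz) h, ?_, ?_⟩
    · rw [add_sing_pair]
      exact fun e => hne (sing_injective (Code.add_eq_zero.1 e))
    · rw [add_sing_pair, bad_pair_iff hne]
      rwa [show z + (y + b) = y + z + b by abel]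
  · have hne : y ≠ z + b := fun e => h0 (by
      rw [add_comm y z, add_assoc, add_comm y b, ← add_assoc, ← e, Code.add_self])
    refine ⟨_, .deep _ z b (add_sing_apply_right hyz) h, ?_, ?_⟩
    · rw [add_comm (sing y), add_sing_pair]
      exact fun e => hne (sing_injective (Code.add_eq_zero.1 e))
    · rw [add_comm (sing y), add_sing_pair, bad_pair_iff hne]
      rwa [← add_assoc]

/-- If exactly one of `y`, `z` has even size, then deleting its root works. -/
theorem exists_mv_pair_of_par {y z : Code} (hp : par (y + z) ≠ 0) :
    ∃ b, Mv (sing y + sing z) b ∧ sing y + sing z + b ≠ 0 ∧ ¬ Bad (sing y + sing z + b) := by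
  have hyz : y ≠ z := by rintro rfl; simp [Code.add_self] at hp
  rw [map_add] at hp
  by_cases hy : par y = 0
  · refine ⟨_, .child _ y (add_sing_apply_left hyz) hy, ?_⟩
    rw [add_comm (sing y), add_assoc, Code.add_self, add_zero, bad_sing_iff]
    exact ⟨sing_ne_zero z, by simpa [hy] using hp⟩
  · have hz : par z = 0 := by
      revert hp hy; generalize par y = a; generalize par z = b; revert a b; decide
    refine ⟨_, .child _ z (add_sing_apply_right hyz) hz, ?_⟩
    rw [add_assoc, Code.add_self, add_zero, bad_sing_iff]
    exact ⟨sing_ne_zero y, hy⟩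

/-- Induction on badness. If `y + z` has even size, its move lifts to the pair. Otherwise one of
`y`, `z` has even size, and deleting its root leaves the singleton of a set of odd size, which is
not bad. -/
theorem Bad.exists_mv {x : Code} (h : Bad x) (hp : par x = 0) :
    ∃ b, Mv x b ∧ x + b ≠ 0 ∧ ¬ Bad (x + b) := by
  induction h with
  | one y _ => simp at hp
  | two y z h ih =>
    by_cases hD : par (y + z) = 0
    · obtain ⟨b, hb, h0, hnb⟩ := ih hD
      exact exists_mv_pair (fun e => h.ne_zero (Code.add_eq_zero.2 e)) hb hnb h0
    · exact exists_mv_pair_of_par hD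

/-- A child of odd size is nonempty, so a descent through such children ends at a child of even
size, which may be deleted. -/
theorem exists_mv {x : Code} (h : x ≠ 0) : ∃ b, Mv x b := by
  induction hn : enc x using Nat.strong_induction_on generalizing x with
  | _ n ih =>
    obtain ⟨y, hy⟩ := exists_mem_of_ne_zero h
    by_cases hp : par y = 0
    · exact ⟨_, .child x y hy hp⟩
    · obtain ⟨b, hb⟩ := ih (enc y) (hn ▸ enc_lt_of_mem hy)
        (by rintro rfl; simp at hp) rfl
      exact ⟨_, .deep x y b hy hb⟩

/-- A nonzero code has a move to another nonzero code if its size is even. -/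
theorem exists_mv_add_ne_zero {x : Code} (h : x ≠ 0) (hp : par x = 0) : ∃ b, Mv x b ∧ x + b ≠ 0 := by
  by_cases hb : Bad x
  · obtain ⟨b, h1, h2, _⟩ := hb.exists_mv hp
    exact ⟨b, h1, h2⟩
  · obtain ⟨b, h1⟩ := exists_mv h
    exact ⟨b, h1, fun e => hb (Code.add_eq_zero.1 e ▸ h1.bad)⟩

theorem Mv.enc_lt {x b : Code} (h : Mv x b) : enc (x + b) < enc x := by
  induction h with
  | child x y hy _ =>
    have := enc_add_sing hy
    have := Nat.two_pow_pos (enc y)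
    omega
  | deep x y b hy _ ih =>
    have h1 := enc_add_sing hy
    have h2 := enc_add_le (x + sing y) (sing (y + b))
    rw [enc_sing, add_assoc] at h2
    have := Nat.pow_lt_pow_right (a := 2) (by norm_num) ih
    omega

theorem Bad.card_support_le {x : Code} (h : Bad x) : x.support.card ≤ 2 := by
  have hs : ∀ y : Code, (sing y).support.card = 1 := fun y => by
    simp [sing]
  cases h with
  | one y _ => rw [hs]; norm_num
  | two y z _ =>
    classical
    refine (Finset.card_le_card Finsupp.support_add).trans ((Finset.card_union_le _ _).trans ?_)
    rw [hs, hs]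

theorem par_eq_card (x : Code) : par x = (x.support.card : ZMod 2) := by
  simp only [par, Finsupp.liftAddHom_apply, Finsupp.sum, AddMonoidHom.id_apply]
  rw [Finset.sum_congr rfl fun i hi => Code.apply_eq_one (by simpa using hi)]
  simp

/-- Bad sets have at most two elements, so it suffices to keep three. The move is made in the child
of least number: what replaces it is smaller still (`Mv.enc_lt`) and cannot cancel another child. -/
theorem exists_mv_of_card {x : Code} (h : 4 ≤ x.support.card) : ∃ b, Mv x b ∧ ¬ Bad (x + b) := by
  classical
  have hne : x.support.Nonempty := Finset.card_pos.1 (by omega)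
  obtain ⟨y, hy⟩ := enc_surjective (x.support.min' hne)
  have hmem : x (enc y) ≠ 0 := by
    have := x.support.min'_mem hne
    rw [← hy] at this; simpa using this
  have hmin : ∀ w : Code, x (enc w) ≠ 0 → enc y ≤ enc w := fun w hw => by
    rw [hy]; exact Finset.min'_le _ _ (by simpa using hw)
  have hsub : x.support.erase (enc y) ⊆ (x + sing y).support := by
    intro i hi
    rw [Finset.mem_erase, Finsupp.mem_support_iff] at hi
    simp [sing, hi.1, hi.2]
  have hcard : 3 ≤ (x.support.erase (enc y)).card := by
    rw [Finset.card_erase_of_mem (by simpa using hmem)]; omega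
  by_cases hp : par y = 0
  · refine ⟨_, .child x y hmem hp, fun hb => ?_⟩
    have := (Finset.card_le_card hsub).trans hb.card_support_le
    omega
  · obtain ⟨b, hb⟩ := exists_mv (x := y) (by rintro rfl; simp at hp)
    refine ⟨_, .deep x y b hmem hb, fun hbad => ?_⟩
    have hsub' : x.support.erase (enc y) ⊆ (x + (sing y + sing (y + b))).support := by
      intro i hi
      have hi' := hi
      rw [Finset.mem_erase, Finsupp.mem_support_iff] at hi
      have hne' : i ≠ enc (y + b) := by
        rintro rfl
        exact absurd (hmin _ hi.2) (not_le.2 hb.enc_lt)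
      simp [sing, hi.1, hi.2, hne']
    have := (Finset.card_le_card hsub').trans hbad.card_support_le
    omega

theorem exists_pair_of_card {x : Code} (h : x.support.card = 2) :
    ∃ y z, y ≠ z ∧ x = sing y + sing z := by
  obtain ⟨i, j, hij, hs⟩ := Finset.card_eq_two.1 h
  obtain ⟨y, rfl⟩ := enc_surjective i
  obtain ⟨z, rfl⟩ := enc_surjective j
  have hyz : y ≠ z := fun e => hij (by rw [e])
  refine ⟨y, z, hyz, ?_⟩
  apply Code.add_eq_zero.1
  ext1 k
  by_cases hk : x k = 0
  · have : k ∉ x.support := by simpa using hk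
    rw [hs] at this
    simp only [Finset.mem_insert, Finset.mem_singleton, not_or] at this
    simp [hk, sing, this.1, this.2]
  · have : k ∈ x.support := by simpa using hk
    rw [hs] at this
    simp only [Finset.mem_insert, Finset.mem_singleton] at this
    rw [Finsupp.add_apply, Code.apply_eq_one hk]
    rcases this with rfl | rfl
    · rw [Finsupp.add_apply, sing_apply_self, sing_apply_of_ne hyz.symm, add_zero]
      exact CharTwo.add_self_eq_zero 1
    · rw [Finsupp.add_apply, sing_apply_self, sing_apply_of_ne hyz, zero_add]
      exact CharTwo.add_self_eq_zero 1

/-- A nonzero code that is not bad and has an even number of children and an even number of edges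
has a move to a nonzero code that is not bad. -/
theorem exists_mv_not_bad {x : Code} (h : x ≠ 0) (hp : par x = 0) (he : edgeParity x = 0)
    (hnb : ¬ Bad x) : ∃ b, Mv x b ∧ x + b ≠ 0 ∧ ¬ Bad (x + b) := by
  have h0 : ∀ b, Mv x b → x + b ≠ 0 := fun b hb e => hnb (Code.add_eq_zero.1 e ▸ hb.bad)
  induction hn : enc x using Nat.strong_induction_on generalizing x with
  | _ n ih =>
    by_cases hc : 4 ≤ x.support.card
    · obtain ⟨b, hb, hb'⟩ := exists_mv_of_card hc
      exact ⟨b, hb, h0 b hb, hb'⟩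
    have heven : Even x.support.card := by
      rw [par_eq_card] at hp
      exact (ZMod.natCast_eq_zero_iff_even).1 hp
    have hpos : x.support.card ≠ 0 := by simpa using h
    have h2 : x.support.card = 2 := by
      rcases heven with ⟨k, hk⟩; omega
    obtain ⟨y, z, hyz, rfl⟩ := exists_pair_of_card h2
    -- Merging the two children into `y + z` loses two edges, keeps the code nonzero and not bad,
    -- and lowers its number, so the induction applies to it.
    by_cases hD : par (y + z) = 0
    · have hD0 : y + z ≠ 0 := fun e => hyz (Code.add_eq_zero.1 e)
      have hDb : ¬ Bad (y + z) := fun hb => hnb (.two y z hb)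
      have hDe : edgeParity (y + z) = 0 := by
        simp only [map_add, edgeParity_sing] at he ⊢
        revert he; generalize edgeParity y = a; generalize edgeParity z = b; revert a b; decide
      have hlt : enc (y + z) < n := by
        have h1 := enc_add_le y z
        have h3 := enc_add_sing (add_sing_apply_left hyz)
        rw [add_comm (sing y), add_assoc, Code.add_self, add_zero, enc_sing, add_comm (sing z)] at h3
        have := Nat.lt_two_pow_self (n := enc y)
        have := Nat.lt_two_pow_self (n := enc z)
        omega
      obtain ⟨b, hb, hb0, hb'⟩ := ih _ hlt hD0 hD hDe hDb
        (fun b hb e => hDb (Code.add_eq_zero.1 e ▸ hb.bad)) rfl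
      exact exists_mv_pair hyz hb hb' hb0
    · exact exists_mv_pair_of_par hD

end GraphTakeaway

namespace GraphTakeaway

/-! ### Rooted forests and the codes of their subgraphs -/

/-- A choice of a root in each component of a forest `F`, recorded by parents and depths. -/
structure RootedForest {V : Type*} (F : SimpleGraph V) where
  /-- The parent of a vertex that is not a root. -/
  parent : V → V
  /-- The distance to the root. -/
  depth : V → ℕ
  adj_parent : ∀ v, depth v ≠ 0 → F.Adj v (parent v)
  depth_parent : ∀ v, depth v ≠ 0 → depth v = depth (parent v) + 1
  of_adj : ∀ v w, F.Adj v w → (depth w ≠ 0 ∧ parent w = v) ∨ (depth v ≠ 0 ∧ parent v = w)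

namespace RootedForest

variable {V : Type*} {G F : SimpleGraph V} (T : RootedForest F) (H : G.Subgraph)

/-- In `H`, the vertex `w` is a child of `v`. -/
def Kid (w v : V) : Prop := T.depth w ≠ 0 ∧ T.parent w = v ∧ H.Adj v w

/-- `t` is `v` or a descendant of `v` in `H`. -/
def Below (t v : V) : Prop := Relation.ReflTransGen (T.Kid H) t v

variable {T H}

theorem Kid.depth_eq {w v : V} (h : T.Kid H w v) : T.depth w = T.depth v + 1 := by
  rw [← h.2.1]; exact T.depth_parent w h.1

theorem Kid.unique {w v v' : V} (h : T.Kid H w v) (h' : T.Kid H w v') : v = v' :=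
  h.2.1.symm.trans h'.2.1

theorem Kid.not_symm {w v : V} (h : T.Kid H w v) : ¬ T.Kid H v w := fun h' => by
  have := h.depth_eq; have := h'.depth_eq; omega

theorem Kid.adj {w v : V} (h : T.Kid H w v) : F.Adj v w := by
  have := T.adj_parent w h.1
  rw [h.2.1] at this
  exact this.symm

theorem kid_or_kid {v w : V} (hF : F.Adj v w) (h : H.Adj v w) : T.Kid H w v ∨ T.Kid H v w :=
  (T.of_adj v w hF).imp (fun h' => ⟨h'.1, h'.2, h⟩) fun h' => ⟨h'.1, h'.2, h.symm⟩

theorem Below.depth_le {t v : V} (h : T.Below H t v) : T.depth v ≤ T.depth t := by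
  induction h with
  | refl => exact le_rfl
  | tail _ h ih => have := h.depth_eq; omega

theorem Below.eq_or_kid {t v : V} (h : T.Below H t v) : t = v ∨ ∃ w, T.Kid H t w ∧ T.Below H w v :=
  (Relation.ReflTransGen.cases_head h).imp id fun ⟨w, h1, h2⟩ => ⟨w, h1, h2⟩

theorem Below.eq_of_depth {t v : V} (h : T.Below H t v) (hd : T.depth t ≤ T.depth v) : t = v := by
  rcases h.eq_or_kid with rfl | ⟨w, h1, h2⟩
  · rfl
  · have := h1.depth_eq; have := h2.depth_le; omega

theorem Below.total {t a b : V} (ha : T.Below H t a) (hb : T.Below H t b) :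
    T.Below H a b ∨ T.Below H b a :=
  Relation.ReflTransGen.total_of_right_unique (fun _ _ _ h h' => h.unique h') ha hb

theorem Below.kid_unique {t v w w' : V} (hw : T.Kid H w v) (hw' : T.Kid H w' v)
    (h : T.Below H t w) (h' : T.Below H t w') : w = w' := by
  have h1 := hw.depth_eq
  have h2 := hw'.depth_eq
  rcases h.total h' with h | h
  · exact h.eq_of_depth (by omega)
  · exact (h.eq_of_depth (by omega)).symm

theorem Below.depth_lt {t v : V} (h : T.Below H t v) (hne : t ≠ v) : T.depth v < T.depth t := by
  by_contra hc
  exact hne (h.eq_of_depth (by omega))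

theorem Below.mem_verts {t v : V} (h : T.Below H t v) (hv : v ∈ H.verts) : t ∈ H.verts := by
  rcases h.eq_or_kid with rfl | ⟨w, h1, _⟩
  · exact hv
  · exact h1.2.2.snd_mem

theorem kid_deleteVerts {S : Set V} {w v : V} :
    T.Kid (H.deleteVerts S) w v ↔ T.Kid H w v ∧ v ∉ S ∧ w ∉ S := by
  simp only [Kid, SimpleGraph.Subgraph.deleteVerts_adj]
  constructor
  · rintro ⟨h1, h2, h3, h4, h5, h6, h7⟩
    exact ⟨⟨h1, h2, h7⟩, h4, h6⟩
  · rintro ⟨⟨h1, h2, h3⟩, h4, h5⟩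
    exact ⟨h1, h2, h3.fst_mem, h4, h3.snd_mem, h5, h3⟩

variable [Fintype V]

variable (T H) in
open Classical in
/-- The children of `v` in `H`. -/
noncomputable def kids (v : V) : Finset V := Finset.univ.filter fun w => T.Kid H w v

@[simp] theorem mem_kids {v w : V} : w ∈ T.kids H v ↔ T.Kid H w v := by simp [kids]

variable (T H) in
/-- The code of the tree formed by the descendants of `v` in `H`, after cancellation. -/
noncomputable def code (v : V) : Code := ∑ w ∈ (T.kids H v).attach, sing (code w.1)
-- Children are deeper than `v`, and depth is bounded because `V` is finite.
termination_by Finset.univ.sup T.depth - T.depth v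
decreasing_by
  have h1 := (mem_kids.1 w.2).depth_eq
  have h2 : T.depth w.1 ≤ Finset.univ.sup T.depth := Finset.le_sup (Finset.mem_univ _)
  omega

theorem code_eq (v : V) : T.code H v = ∑ w ∈ T.kids H v, sing (T.code H w) := by
  rw [code, Finset.sum_attach (T.kids H v) fun w => sing (T.code H w)]

variable (T H) in
theorem kid_induction {P : V → Prop} (h : ∀ v, (∀ w, T.Kid H w v → P w) → P v) (v : V) : P v := by
  induction hn : Finset.univ.sup T.depth - T.depth v using Nat.strong_induction_on
    generalizing v with
  | _ n ih =>
    refine h v fun w hw => ih _ ?_ w rfl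
    have h1 := hw.depth_eq
    have h2 : T.depth w ≤ Finset.univ.sup T.depth := Finset.le_sup (Finset.mem_univ _)
    omega

theorem par_code (v : V) : par (T.code H v) = ((T.kids H v).card : ZMod 2) := by
  rw [code_eq, map_sum]; simp

theorem code_deleteVerts_of_not_below {t v : V} (h : ¬ T.Below H t v) :
    T.code (H.deleteVerts {t}) v = T.code H v := by
  induction v using T.kid_induction H with
  | h v ih =>
    have hne : v ≠ t := by rintro rfl; exact h .refl
    have hk : ∀ w, T.Kid H w v → ¬ T.Below H t w := fun w hw hb => h (hb.tail hw)
    have hkids : T.kids (H.deleteVerts {t}) v = T.kids H v := by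
      ext w
      simp only [mem_kids, kid_deleteVerts, Set.mem_singleton_iff]
      exact ⟨fun h => h.1, fun hw => ⟨hw, hne, by rintro rfl; exact hk _ hw .refl⟩⟩
    rw [code_eq, hkids, code_eq]
    exact Finset.sum_congr rfl fun w hw => by
      rw [ih w (mem_kids.1 hw) (hk w (mem_kids.1 hw))]

theorem code_deleteVerts_kid {t v : V} (h : T.Kid H t v) :
    T.code (H.deleteVerts {t}) v = T.code H v + sing (T.code H t) := by
  classical
  have hne : v ≠ t := by rintro rfl; exact h.not_symm h
  have hkids : T.kids (H.deleteVerts {t}) v = (T.kids H v).erase t := by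
    ext w
    simp only [mem_kids, kid_deleteVerts, Set.mem_singleton_iff, Finset.mem_erase]
    tauto
  rw [code_eq, hkids, code_eq v, ← Finset.sum_erase_add _ _ (mem_kids.2 h), add_assoc,
    Code.add_self, add_zero]
  refine Finset.sum_congr rfl fun w hw => ?_
  rw [Finset.mem_erase, mem_kids] at hw
  rw [code_deleteVerts_of_not_below]
  intro hb
  exact hw.1 (Below.kid_unique hw.2 h hb .refl)

/-- A vertex has at most one child above `t`, so a single summand is exchanged. -/
theorem code_deleteVerts_below {t w v : V} (h : T.Kid H w v) (hb : T.Below H t w) (hne : t ≠ w) :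
    T.code (H.deleteVerts {t}) v =
      T.code H v + (sing (T.code H w) + sing (T.code (H.deleteVerts {t}) w)) := by
  classical
  have hd := h.depth_eq
  have hd' := hb.depth_lt hne
  have hkids : T.kids (H.deleteVerts {t}) v = T.kids H v := by
    ext x
    simp only [mem_kids, kid_deleteVerts, Set.mem_singleton_iff]
    refine ⟨fun h => h.1, fun hx => ⟨hx, by rintro rfl; omega, ?_⟩⟩
    rintro rfl
    have := hx.depth_eq
    omega
  rw [code_eq, hkids, code_eq v, ← Finset.sum_erase_add _ _ (mem_kids.2 h),
    ← Finset.sum_erase_add (T.kids H v) (fun x => sing (T.code H x)) (mem_kids.2 h), add_assoc,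
    Code.add_add_cancel]
  congr 1
  refine Finset.sum_congr rfl fun x hx => ?_
  rw [Finset.mem_erase, mem_kids] at hx
  rw [code_deleteVerts_of_not_below]
  intro hb'
  exact hx.1 (Below.kid_unique hx.2 h hb' hb)

/-- Deleting a vertex with an even number of children changes the codes of the vertices above it by
a bad code, if at all. -/
theorem code_deleteVerts_bad {t v : V} (hp : par (T.code H t) = 0) (h : T.Below H t v)
    (hne : t ≠ v) : T.code (H.deleteVerts {t}) v = T.code H v ∨
      Bad (T.code H v + T.code (H.deleteVerts {t}) v) := by
  induction h with
  | refl => exact absurd rfl hne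
  | @tail w v hb hk ih =>
    by_cases htw : t = w
    · subst htw
      rw [code_deleteVerts_kid hk, Code.add_add_cancel]
      exact .inr (.one _ hp)
    · rw [code_deleteVerts_below hk hb htw, Code.add_add_cancel]
      rcases ih htw with h | h
      · rw [h, Code.add_self, add_zero]; exact .inl rfl
      · exact .inr (.two _ _ h)

theorem exists_kid_of_mem {v : V} {y : Code} (h : T.code H v (enc y) ≠ 0) :
    ∃ w, T.Kid H w v ∧ T.code H w = y := by
  by_contra! hc
  apply h
  rw [code_eq, Finsupp.finsetSum_apply]
  exact Finset.sum_eq_zero fun w hw => sing_apply_of_ne (hc w (mem_kids.1 hw))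

/-- Every move of codes comes from the deletion of a vertex. -/
theorem exists_below_of_mv {x b : Code} (h : Mv x b) {v : V} (hv : T.code H v = x) :
    ∃ t, T.Below H t v ∧ t ≠ v ∧ par (T.code H t) = 0 ∧
      T.code (H.deleteVerts {t}) v = x + b := by
  induction h generalizing v with
  | child x y hy hp =>
    obtain ⟨w, hw, rfl⟩ := exists_kid_of_mem (hv ▸ hy)
    refine ⟨w, .single hw, ?_, hp, ?_⟩
    · rintro rfl; exact hw.not_symm hw
    · rw [code_deleteVerts_kid hw, hv]
  | deep x y b hy _ ih =>
    obtain ⟨w, hw, rfl⟩ := exists_kid_of_mem (hv ▸ hy)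
    obtain ⟨t, ht, hne, hp, hcode⟩ := ih rfl
    refine ⟨t, ht.tail hw, ?_, hp, ?_⟩
    · rintro rfl
      have := ht.depth_le
      have := hw.depth_eq
      omega
    · rw [code_deleteVerts_below hw ht hne, hcode, hv]

open Classical in
/-- The vertices that are not roots in `H`. -/
noncomputable def nonroots (T : RootedForest F) (H : G.Subgraph) : Finset V :=
  Finset.univ.filter fun w => ∃ v, T.Kid H w v

open Classical in
theorem sum_kids_eq {M : Type*} [AddCommMonoid M] (f : V → M) :
    ∑ v, ∑ w ∈ T.kids H v, f w = ∑ w ∈ T.nonroots H, f w := by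
  rw [Finset.sum_comm' (t' := T.nonroots H)
    (s' := fun w => Finset.univ.filter fun v => T.Kid H w v)]
  · refine Finset.sum_congr rfl fun w hw => ?_
    obtain ⟨v, hv⟩ : ∃ v, T.Kid H w v := by simpa [nonroots] using hw
    have : (Finset.univ.filter fun v => T.Kid H w v) = {v} := by
      ext x
      simp only [Finset.mem_filter, Finset.mem_univ, true_and, Finset.mem_singleton]
      exact ⟨fun h => h.unique hv, fun h => h ▸ hv⟩
    rw [this, Finset.sum_singleton]
  · intro v w
    simp only [Finset.mem_univ, mem_kids, true_and, Finset.mem_filter, nonroots]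
    exact ⟨fun h => ⟨h, v, h⟩, fun h => h.1⟩

open Classical in
/-- The number of edges of the forest in `H`, modulo two, is determined by the codes of roots. -/
theorem card_nonroots_eq :
    ((T.nonroots H).card : ZMod 2) = ∑ v ∈ (T.nonroots H)ᶜ, edgeParity (T.code H v) := by
  have h1 : ∀ v, edgeParity (T.code H v) =
      ∑ w ∈ T.kids H v, (1 + edgeParity (T.code H w)) := fun v => by
    rw [code_eq, map_sum]; simp
  -- Summed over all vertices, each nonroot occurs once as a child, so the edge parities of nonroots
  -- cancel and only those of roots remain.
  have h2 := Finset.sum_congr (s₁ := Finset.univ) rfl fun v _ => h1 v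
  rw [sum_kids_eq, Finset.sum_add_distrib, ← Finset.sum_add_sum_compl (T.nonroots H),
    add_comm, Finset.sum_const, nsmul_eq_mul, mul_one] at h2
  exact (add_right_cancel h2).symm

end RootedForest

end GraphTakeaway

namespace GraphTakeaway

variable {V : Type*} {G : SimpleGraph V}

/-! ### Existence of rooted forests -/

theorem exists_rootedForest {F : SimpleGraph V} (hF : F.IsAcyclic) (R : Set V)
    (hR : ∀ a ∈ R, ∀ b ∈ R, F.Reachable a b → a = b) :
    ∃ T : RootedForest F, ∀ c ∈ R, T.depth c = 0 := by
  classical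
  -- A component that meets `R` does so in one vertex by `hR`, and this is its root; other roots are
  -- arbitrary.
  let root : F.ConnectedComponent → V := fun Q =>
    if h : ∃ c ∈ R, F.connectedComponentMk c = Q then h.choose else Q.out
  have hroot : ∀ Q, F.connectedComponentMk (root Q) = Q := fun Q => by
    by_cases h : ∃ c ∈ R, F.connectedComponentMk c = Q
    · simp only [root, dif_pos h]; exact h.choose_spec.2
    · simp only [root, dif_neg h]; exact Quot.out_eq Q
  let r : V → V := fun v => root (F.connectedComponentMk v)
  have hr : ∀ v, F.Reachable (r v) v := fun v =>
    SimpleGraph.ConnectedComponent.exact (hroot (F.connectedComponentMk v))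
  have hradj : ∀ v w, F.Adj v w → r v = r w := fun v w h =>
    congrArg root (SimpleGraph.ConnectedComponent.sound h.reachable)
  choose p hp hlen using fun v => (hr v).exists_path_of_dist
  have hnil : ∀ v, F.dist (r v) v ≠ 0 → ¬ (p v).Nil := fun v h hn => by
    rw [← hlen, SimpleGraph.Walk.length_eq_zero_iff.2 hn] at h
    exact h rfl
  -- Paths in a forest are unique, so the chosen path to `w` is the one to `v` extended by an edge.
  have key : ∀ v w, F.Adj v w → F.dist (r v) w = F.dist (r v) v + 1 → (p w).penultimate = v := by
    intro v w h hd
    have hrw := hradj v w h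
    have hpath : ∀ a (q : F.Walk a w), a = r v → q.IsPath → q.penultimate = v := by
      rintro a q rfl hq
      have hq' : ((p v).concat h).IsPath := SimpleGraph.Walk.isPath_of_length_eq_dist _ (by
        rw [SimpleGraph.Walk.length_concat, hlen, hd])
      have := congrArg Subtype.val ((hF.subsingleton_path (r v) w).elim ⟨q, hq⟩ ⟨_, hq'⟩)
      dsimp only at this
      rw [this, SimpleGraph.Walk.penultimate_concat]
    exact hpath _ _ hrw.symm (hp w)
  have hpar : ∀ v, F.dist (r v) v ≠ 0 → F.Adj v (p v).penultimate := fun v h =>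
    (SimpleGraph.Walk.adj_penultimate (hnil v h)).symm
  refine ⟨⟨fun v => (p v).penultimate, fun v => F.dist (r v) v, hpar, ?_, ?_⟩, ?_⟩
  · intro v hv
    have hadj := hpar v hv
    rw [← hradj _ _ hadj]
    have h1 : F.dist (r v) (p v).penultimate ≤ (p v).dropLast.length := F.dist_le _
    have h2 := congrArg SimpleGraph.Walk.length (SimpleGraph.Walk.concat_dropLast hadj.symm)
    rw [SimpleGraph.Walk.length_concat, hlen] at h2
    have h3 := hF.dist_eq_dist_add_one_of_adj_of_reachable (r v) hadj (hr v)
    omega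
  · intro v w h
    have hrw := hradj v w h
    rcases hF.dist_eq_dist_add_one_of_adj_of_reachable (r v) h (hr v) with hd | hd
    · right
      refine ⟨by omega, key w v h.symm ?_⟩
      rw [← hrw]; exact hd
    · left
      exact ⟨by rw [← hrw]; omega, key v w h hd⟩
  · intro c hc
    have h : ∃ c' ∈ R, F.connectedComponentMk c' = F.connectedComponentMk c := ⟨c, hc, rfl⟩
    have : r c = c := by
      simp only [r, root, dif_pos h]
      exact hR _ h.choose_spec.1 _ hc (SimpleGraph.ConnectedComponent.exact h.choose_spec.2)
    simp only
    rw [this, SimpleGraph.dist_self]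

theorem RootedForest.Below.reachable {F : SimpleGraph V} {T : RootedForest F}
    {H : G.Subgraph} {t v : V} (h : T.Below H t v) : F.Reachable v t := by
  induction h with
  | refl => rfl
  | tail _ h ih => exact h.adj.reachable.trans ih

/-! ### Graphs with a unique cycle -/

section Cycle

variable {u : V} {C : G.Walk u u}

theorem acyclic_deleteEdges_of_mem
    (hone : ∀ (w : V) (D : G.Walk w w), D.IsCycle → D.toSubgraph = C.toSubgraph)
    {S : Set (Sym2 V)} {e : Sym2 V} (he : e ∈ C.edges) (heS : e ∈ S) :
    (G.deleteEdges S).IsAcyclic := by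
  intro w D hD
  have h1 := hone w _ (hD.mapLe (G.deleteEdges_le S))
  have h2 : e ∈ (D.mapLe (G.deleteEdges_le S)).toSubgraph.edgeSet := by
    rw [h1]; exact C.mem_edges_toSubgraph.2 he
  rw [SimpleGraph.Walk.mem_edges_toSubgraph, SimpleGraph.Walk.edges_mapLe_eq_edges] at h2
  have := D.edges_subset_edgeSet h2
  rw [SimpleGraph.edgeSet_deleteEdges] at this
  exact this.2 heS

theorem exists_mem_edges (hC : C.IsCycle) : ∃ e, e ∈ C.edges := by
  have := hC.three_le_length
  rw [← SimpleGraph.Walk.length_edges] at this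
  exact List.exists_mem_of_length_pos (by omega)

/-- A path from `b` to `a` off the cycle and an arc of the cycle would both lie in the forest left
when a cycle edge at `a` is removed. They would coincide, although one uses only cycle edges and the
other none. -/
theorem eq_of_reachable_deleteEdges (hC : C.IsCycle)
    (hone : ∀ (w : V) (D : G.Walk w w), D.IsCycle → D.toSubgraph = C.toSubgraph)
    {a b : V} (ha : a ∈ C.support) (hb : b ∈ C.support)
    (h : (G.deleteEdges {e | e ∈ C.edges}).Reachable a b) : a = b := by
  classical
  by_contra hne
  have hC' := hC.rotate ha
  have hedge : ∀ e, e ∈ (C.rotate a ha).edges ↔ e ∈ C.edges := fun e =>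
    (C.rotate_edges a ha).mem_iff
  have hb' : b ∈ (C.rotate a ha).support := (C.mem_support_rotate_iff a ha).2 hb
  generalize C.rotate a ha = D at hC' hedge hb'
  cases D with
  | nil => exact hC'.ne_nil rfl
  | @cons _ x _ hadj p =>
    rw [SimpleGraph.Walk.cons_isCycle_iff] at hC'
    rw [SimpleGraph.Walk.support_cons, List.mem_cons] at hb'
    have hbp : b ∈ p.support := hb'.resolve_left fun h => hne h.symm
    have he : s(a, x) ∈ C.edges := (hedge _).1 (by simp)
    have hac := acyclic_deleteEdges_of_mem hone he (Set.mem_singleton s(a, x))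
    let q := p.dropUntil b hbp
    have hqp : ∀ e ∈ q.edges, e ∈ p.edges := fun e h => p.edges_dropUntil_subset_edges hbp h
    have hq : ∀ e ∈ q.edges, e ∈ (G.deleteEdges {s(a, x)}).edgeSet := by
      intro e h
      rw [SimpleGraph.edgeSet_deleteEdges]
      refine ⟨q.edges_subset_edgeSet h, ?_⟩
      rintro rfl
      exact hC'.2 (hqp _ h)
    obtain ⟨⟨w, hw⟩⟩ := (h.symm).elim fun w => (⟨w.toPath⟩ : Nonempty _)
    have hle : G.deleteEdges {e | e ∈ C.edges} ≤ G.deleteEdges {s(a, x)} :=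
      G.deleteEdges_anti (Set.singleton_subset_iff.2 he)
    have heq := congrArg Subtype.val ((hac.subsingleton_path b a).elim
      ⟨q.transfer _ hq, (hC'.1.dropUntil hbp).transfer hq⟩ ⟨w.mapLe hle, hw.mapLe hle⟩)
    dsimp only at heq
    have hed := congrArg SimpleGraph.Walk.edges heq
    rw [SimpleGraph.Walk.edges_transfer, SimpleGraph.Walk.edges_mapLe_eq_edges] at hed
    cases hw' : w.edges with
    | nil =>
      have : w.length = 0 := by rw [← SimpleGraph.Walk.length_edges, hw']; rfl
      exact hne (SimpleGraph.Walk.eq_of_length_eq_zero this).symm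
    | cons e l =>
      have hemem : e ∈ w.edges := by rw [hw']; exact List.mem_cons_self
      have h1 := w.edges_subset_edgeSet hemem
      rw [SimpleGraph.edgeSet_deleteEdges] at h1
      have h2 : e ∈ p.edges := hqp e (hed ▸ hemem)
      exact h1.2 ((hedge e).1 (by simp [h2]))

theorem exists_rootedForest_of_cycle (hC : C.IsCycle)
    (hone : ∀ (w : V) (D : G.Walk w w), D.IsCycle → D.toSubgraph = C.toSubgraph) :
    ∃ T : RootedForest (G.deleteEdges {e | e ∈ C.edges}), ∀ c ∈ C.support, T.depth c = 0 := by
  obtain ⟨e, he⟩ := exists_mem_edges hC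
  exact exists_rootedForest (acyclic_deleteEdges_of_mem hone he he) {c | c ∈ C.support}
    fun a ha b hb h => eq_of_reachable_deleteEdges hC hone ha hb h

/-- A cycle in `H` would have to be `C`, so `H` is a forest. -/
theorem colorable_of_not_le (hone : ∀ (w : V) (D : G.Walk w w), D.IsCycle →
    D.toSubgraph = C.toSubgraph) {H : G.Subgraph} (h : ¬ C.toSubgraph ≤ H) :
    H.spanningCoe.Colorable 2 := by
  refine SimpleGraph.IsAcyclic.colorable_two fun w D hD => h ?_
  rw [← hone w _ (hD.mapLe H.spanningCoe_le), SimpleGraph.Walk.toSubgraph_le_iff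
    (by simpa using hD.not_nil)]
  intro e he
  have he : e ∈ (D.mapLe H.spanningCoe_le).edges := he
  rw [SimpleGraph.Walk.edges_mapLe_eq_edges] at he
  simpa using D.edges_subset_edgeSet he

end Cycle

/-! ### Counting vertices and edges after a move -/

section Count

variable {H : G.Subgraph}

/-- The degree of a vertex in a position. -/
noncomputable def deg (H : G.Subgraph) (v : V) : ℕ := (H.neighborSet v).ncard

theorem ncard_verts_deleteVerts [Finite V] {v : V} (hv : v ∈ H.verts) :
    (H.deleteVerts {v}).verts.ncard + 1 = H.verts.ncard := by
  rw [SimpleGraph.Subgraph.deleteVerts_verts]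
  exact Set.ncard_sdiff_singleton_add_one hv

theorem ncard_edgeSet_deleteEdges [Finite V] {e : Sym2 V} (he : e ∈ H.edgeSet) :
    (H.deleteEdges {e}).edgeSet.ncard + 1 = H.edgeSet.ncard := by
  have : (H.deleteEdges {e}).edgeSet = H.edgeSet \ {e} := by
    ext x
    induction x with | _ a b => simp
  rw [this]
  exact Set.ncard_sdiff_singleton_add_one he

theorem ncard_edgeSet_deleteVerts [Finite V] (v : V) :
    (H.deleteVerts {v}).edgeSet.ncard + deg H v = H.edgeSet.ncard := by
  have h : H.edgeSet = (H.deleteVerts {v}).edgeSet ∪ (fun w => s(v, w)) '' H.neighborSet v := by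
    ext x
    induction x with
    | _ a b =>
      simp only [SimpleGraph.Subgraph.mem_edgeSet, Set.mem_union,
        SimpleGraph.Subgraph.deleteVerts_adj, Set.mem_image, SimpleGraph.Subgraph.mem_neighborSet,
        Set.mem_singleton_iff]
      constructor
      · intro hab
        by_cases ha : a = v
        · subst ha; exact .inr ⟨b, hab, rfl⟩
        · by_cases hb : b = v
          · subst hb; exact .inr ⟨a, hab.symm, Sym2.eq_swap⟩
          · exact .inl ⟨hab.fst_mem, ha, hab.snd_mem, hb, hab⟩
      · rintro (h | ⟨w, hw, hx⟩)
        · exact h.2.2.2.2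
        · have : s(v, w) ∈ H.edgeSet := hw
          rw [hx] at this
          exact this
  have hd : Disjoint (H.deleteVerts {v}).edgeSet ((fun w => s(v, w)) '' H.neighborSet v) := by
    rw [Set.disjoint_left]
    rintro _ hx ⟨w, _, rfl⟩
    simp at hx
  rw [h, Set.ncard_union_eq hd (Set.toFinite _) (Set.toFinite _), deg,
    Set.ncard_image_of_injective]
  intro a b hab
  exact Sym2.congr_right.1 hab

/-- By the handshake lemma the number of vertices of odd degree is even. -/
theorem exists_even_deg [Finite V] (h : Odd H.verts.ncard) : ∃ v ∈ H.verts, Even (deg H v) := by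
  classical
  have := Fintype.ofFinite V
  by_contra! hc
  have h1 := H.spanningCoe.even_card_odd_degree_vertices
  have h2 : ∀ v, H.spanningCoe.degree v = deg H v := fun v => by
    rw [deg, Set.ncard_eq_toFinset_card', ← SimpleGraph.card_neighborFinset_eq_degree]
    congr 1
    ext w
    simp
  have h3 : (Finset.univ.filter fun v => Odd (H.spanningCoe.degree v)) = H.verts.toFinset := by
    ext v
    simp only [Finset.mem_filter, Finset.mem_univ, true_and, Set.mem_toFinset, h2]
    refine ⟨fun h => ?_, fun h => Nat.not_even_iff_odd.1 (hc v h)⟩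
    by_contra hv
    have : H.neighborSet v = ∅ := by
      ext w
      simp only [SimpleGraph.Subgraph.mem_neighborSet, Set.mem_empty_iff_false, iff_false]
      exact fun h => hv h.fst_mem
    rw [deg, this] at h
    simp at h
  rw [h3, ← Set.ncard_eq_toFinset_card'] at h1
  exact (Nat.not_even_iff_odd.2 h) h1

/-- Each edge has one end in a given colour class, so the degrees in that class add up to the number
of edges. -/
theorem exists_odd_deg [Finite V] (hcol : H.spanningCoe.Colorable 2) (h : Odd H.edgeSet.ncard) :
    ∃ v ∈ H.verts, Odd (deg H v) := by
  classical
  have := Fintype.ofFinite V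
  by_contra! hc
  obtain ⟨s, t, hst⟩ := SimpleGraph.IsBipartite.exists_isBipartiteWith hcol
  have h2 : ∀ v, H.spanningCoe.degree v = deg H v := fun v => by
    rw [deg, Set.ncard_eq_toFinset_card', ← SimpleGraph.card_neighborFinset_eq_degree]
    congr 1
    ext w
    simp
  have h1 : ∑ v ∈ s.toFinset, H.spanningCoe.degree v = H.spanningCoe.edgeFinset.card :=
    SimpleGraph.isBipartiteWith_sum_degrees_eq_card_edges (t := t.toFinset) (by simpa using hst)
  have h3 : H.spanningCoe.edgeFinset.card = H.edgeSet.ncard := by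
    rw [Set.ncard_eq_toFinset_card']
    congr 1
    ext e
    simp
  rw [← h3, ← h1] at h
  refine Nat.not_even_iff_odd.2 h (Finset.even_sum _ fun v _ => ?_)
  rw [h2]
  by_cases hv : v ∈ H.verts
  · exact Nat.not_odd_iff_even.1 (hc v hv)
  · have : H.neighborSet v = ∅ := by
      ext w
      simp only [SimpleGraph.Subgraph.mem_neighborSet, Set.mem_empty_iff_false, iff_false]
      exact fun h => hv h.fst_mem
    rw [deg, this]
    simp

end Count

/-! ### Nim-values -/

section Nim

variable {H : G.Subgraph}

theorem isMove_deleteVerts {v : V} (hv : v ∈ H.verts) : IsMove H (H.deleteVerts {v}) :=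
  .inl ⟨v, hv, rfl⟩

theorem isMove_deleteEdges {e : Sym2 V} (he : e ∈ H.edgeSet) : IsMove H (H.deleteEdges {e}) :=
  .inr ⟨e, he, rfl⟩

theorem phi_le (H : G.Subgraph) : phi H ≤ 3 := by rw [phi]; omega

theorem exists_mem_edgeSet (h : H.edgeSet.ncard % 2 = 1) : ∃ e, e ∈ H.edgeSet := by
  by_contra! hc
  rw [Set.eq_empty_of_forall_notMem hc] at h
  simp at h

theorem IsMove.le {K : G.Subgraph} (h : IsMove H K) : K ≤ H := h.lt.le

variable [Finite V]

theorem nimValue_set_nonempty (H : G.Subgraph) :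
    {n : ℕ | ∀ K : G.Subgraph, ∀ _ : IsMove H K, nimValue K ≠ n}.Nonempty := by
  obtain ⟨n, hn⟩ := (Set.finite_range fun K : G.Subgraph => nimValue K).exists_notMem
  exact ⟨n, fun K _ h => hn ⟨K, h⟩⟩

theorem le_nimValue {k : ℕ} (h : ∀ j < k, ∃ K, IsMove H K ∧ nimValue K = j) : k ≤ nimValue H := by
  rw [nimValue]
  refine le_csInf (nimValue_set_nonempty H) fun n hn => ?_
  by_contra! hlt
  obtain ⟨K, hK, hKn⟩ := h n hlt
  exact hn K hK hKn

theorem nimValue_eq {k : ℕ} (h0 : ∀ K, IsMove H K → nimValue K ≠ k)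
    (h : ∀ j < k, ∃ K, IsMove H K ∧ nimValue K = j) : nimValue H = k := by
  refine le_antisymm ?_ (le_nimValue h)
  rw [nimValue]
  exact Nat.sInf_le h0

theorem phi_deleteEdges {e : Sym2 V} (he : e ∈ H.edgeSet) :
    phi (H.deleteEdges {e}) = H.verts.ncard % 2 + 2 * (1 - H.edgeSet.ncard % 2) := by
  have := ncard_edgeSet_deleteEdges he
  rw [phi, SimpleGraph.Subgraph.deleteEdges_verts]
  omega

theorem phi_deleteVerts_even {v : V} (hv : v ∈ H.verts) (hd : Even (deg H v)) :
    phi (H.deleteVerts {v}) = (1 - H.verts.ncard % 2) + 2 * (H.edgeSet.ncard % 2) := by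
  have := ncard_edgeSet_deleteVerts (H := H) v
  have := ncard_verts_deleteVerts hv
  rw [Nat.even_iff] at hd
  rw [phi]
  omega

theorem phi_deleteVerts_odd {v : V} (hv : v ∈ H.verts) (hd : Odd (deg H v)) :
    phi (H.deleteVerts {v}) = (1 - H.verts.ncard % 2) + 2 * (1 - H.edgeSet.ncard % 2) := by
  have := ncard_edgeSet_deleteVerts (H := H) v
  have := ncard_verts_deleteVerts hv
  rw [Nat.odd_iff] at hd
  rw [phi]
  omega

theorem phi_ne_of_isMove {K : G.Subgraph} (h : IsMove H K) : phi K ≠ phi H := by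
  rcases h with ⟨v, hv, rfl⟩ | ⟨e, he, rfl⟩
  · rcases Nat.even_or_odd (deg H v) with hd | hd
    · rw [phi_deleteVerts_even hv hd, phi]; omega
    · rw [phi_deleteVerts_odd hv hd, phi]; omega
  · rw [phi_deleteEdges he, phi]; omega

/-- The nim-value of a bipartite graph is given by the parity function. -/
theorem nimValue_eq_phi_of_colorable (h : H.spanningCoe.Colorable 2) : nimValue H = phi H := by
  induction H using (wellFounded_lt (α := G.Subgraph)).induction with
  | _ H ih =>
    have ih' : ∀ K, IsMove H K → nimValue K = phi K := fun K hK =>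
      ih K hK.lt (h.mono_left (SimpleGraph.Subgraph.spanningCoe_le_of_le hK.le))
    refine nimValue_eq (fun K hK => (ih' K hK).symm ▸ phi_ne_of_isMove hK) fun j hj => ?_
    have hE : H.edgeSet.ncard % 2 = 1 → ∃ K, IsMove H K ∧ nimValue K = H.verts.ncard % 2 := by
      intro hm
      obtain ⟨e, he⟩ := exists_mem_edgeSet hm
      refine ⟨_, isMove_deleteEdges he, ?_⟩
      rw [ih' _ (isMove_deleteEdges he), phi_deleteEdges he]; omega
    have hV : H.verts.ncard % 2 = 1 →
        ∃ K, IsMove H K ∧ nimValue K = 2 * (H.edgeSet.ncard % 2) := by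
      intro hn
      obtain ⟨v, hv, hd⟩ := exists_even_deg (Nat.odd_iff.2 hn)
      refine ⟨_, isMove_deleteVerts hv, ?_⟩
      rw [ih' _ (isMove_deleteVerts hv), phi_deleteVerts_even hv hd]; omega
    have hO : H.edgeSet.ncard % 2 = 1 → ∃ K, IsMove H K ∧ nimValue K = 1 - H.verts.ncard % 2 := by
      intro hm
      obtain ⟨v, hv, hd⟩ := exists_odd_deg h (Nat.odd_iff.2 hm)
      refine ⟨_, isMove_deleteVerts hv, ?_⟩
      rw [ih' _ (isMove_deleteVerts hv), phi_deleteVerts_odd hv hd]; omega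
    rw [phi] at hj
    have h2 := Nat.mod_two_eq_zero_or_one H.verts.ncard
    have h3 := Nat.mod_two_eq_zero_or_one H.edgeSet.ncard
    -- A flip lowers the value just when the highest bit flipped was 1; the edge bit is the higher
    -- one.
    have hj' : (H.edgeSet.ncard % 2 = 1 ∧ j = H.verts.ncard % 2) ∨
        (H.verts.ncard % 2 = 1 ∧ j = 2 * (H.edgeSet.ncard % 2)) ∨
        (H.edgeSet.ncard % 2 = 1 ∧ j = 1 - H.verts.ncard % 2) := by omega
    rcases hj' with ⟨h, rfl⟩ | ⟨h, rfl⟩ | ⟨h, rfl⟩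
    · exact hE h
    · exact hV h
    · exact hO h

end Nim

end GraphTakeaway

namespace GraphTakeaway

variable {V : Type*} {G : SimpleGraph V}

/-! ### Positions that contain the cycle -/

section Unicyclic

variable {u : V} {C : G.Walk u u} {H : G.Subgraph}
  {T : RootedForest (G.deleteEdges {e | e ∈ C.edges})}

theorem mem_verts_of_mem_support (hH : C.toSubgraph ≤ H) {c : V} (hc : c ∈ C.support) :
    c ∈ H.verts := hH.1 (C.mem_verts_toSubgraph.2 hc)

theorem not_mem_support_of_kid (hroot : ∀ c ∈ C.support, T.depth c = 0) {w v : V}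
    (h : T.Kid H w v) : w ∉ C.support := fun hw => h.1 (hroot w hw)

theorem mem_edges_or_kid {v w : V} (h : H.Adj v w) :
    s(v, w) ∈ C.edges ∨ T.Kid H w v ∨ T.Kid H v w := by
  by_cases he : s(v, w) ∈ C.edges
  · exact .inl he
  · exact .inr (RootedForest.kid_or_kid
      ((SimpleGraph.deleteEdges_adj).2 ⟨H.adj_sub h, he⟩) h)

theorem not_mem_edges_of_kid {v w : V} (h : T.Kid H w v) : s(v, w) ∉ C.edges :=
  ((SimpleGraph.deleteEdges_adj).1 h.adj).2

theorem not_kid_of_mem_support (hroot : ∀ c ∈ C.support, T.depth c = 0) {c v : V}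
    (hc : c ∈ C.support) : ¬ T.Kid H c v := fun h => h.1 (hroot c hc)

/-- Only one cycle vertex can be above a given vertex. -/
theorem eq_of_below {t r c : V} (hr : ∀ v, ¬ T.Kid H r v) (hc : ∀ v, ¬ T.Kid H c v)
    (h : T.Below H t r) (h' : T.Below H t c) : r = c := by
  rcases h.total h' with h | h
  · exact h.eq_or_kid.resolve_right fun ⟨w, hw, _⟩ => hr w hw
  · exact (h.eq_or_kid.resolve_right fun ⟨w, hw, _⟩ => hc w hw).symm

theorem toSubgraph_le_deleteVerts_iff (hH : C.toSubgraph ≤ H) (S : Set V) :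
    C.toSubgraph ≤ H.deleteVerts S ↔ ∀ c ∈ C.support, c ∉ S := by
  constructor
  · intro h c hc
    have := h.1 (C.mem_verts_toSubgraph.2 hc)
    rw [SimpleGraph.Subgraph.deleteVerts_verts] at this
    exact this.2
  · intro h
    refine ⟨fun c hc => ?_, fun a b hab => ?_⟩
    · rw [SimpleGraph.Subgraph.deleteVerts_verts]
      exact ⟨hH.1 hc, h c (C.mem_verts_toSubgraph.1 hc)⟩
    · rw [SimpleGraph.Subgraph.deleteVerts_adj]
      exact ⟨hH.1 hab.fst_mem, h a (C.mem_verts_toSubgraph.1 hab.fst_mem), hH.1 hab.snd_mem,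
        h b (C.mem_verts_toSubgraph.1 hab.snd_mem), hH.2 hab⟩

theorem not_toSubgraph_le_deleteEdges {e : Sym2 V} (he : e ∈ C.edges) :
    ¬ C.toSubgraph ≤ H.deleteEdges {e} := by
  intro h
  have := SimpleGraph.Subgraph.edgeSet_mono h (C.mem_edges_toSubgraph.2 he)
  induction e with | _ a b => simp at this

theorem toSubgraph_le_deleteEdges (hH : C.toSubgraph ≤ H) {e : Sym2 V} (he : e ∉ C.edges) :
    C.toSubgraph ≤ H.deleteEdges {e} := by
  refine ⟨fun c hc => hH.1 hc, fun a b hab => ?_⟩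
  rw [SimpleGraph.Subgraph.deleteEdges_adj]
  refine ⟨hH.2 hab, ?_⟩
  rintro rfl
  exact he (SimpleGraph.Walk.adj_toSubgraph_iff_mem_edges.1 hab)

theorem exists_three_mem_support (hC : C.IsCycle) :
    ∃ a ∈ C.support, ∃ b ∈ C.support, ∃ c ∈ C.support, a ≠ b ∧ a ≠ c ∧ b ≠ c := by
  refine ⟨u, C.start_mem_support, C.snd, C.getVert_mem_support _, C.penultimate,
    C.getVert_mem_support _, ?_, ?_, hC.snd_ne_penultimate⟩
  · exact (C.adj_snd hC.not_nil).ne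
  · exact (C.adj_penultimate hC.not_nil).ne'

variable [Fintype V]

theorem deg_of_mem_support (hC : C.IsCycle) (hroot : ∀ c ∈ C.support, T.depth c = 0)
    (hH : C.toSubgraph ≤ H) {c : V} (hc : c ∈ C.support) :
    deg H c = 2 + (T.kids H c).card := by
  have h : H.neighborSet c = C.toSubgraph.neighborSet c ∪ (T.kids H c : Set V) := by
    ext w
    simp only [SimpleGraph.Subgraph.mem_neighborSet, Set.mem_union, Finset.mem_coe,
      RootedForest.mem_kids]
    constructor
    · intro h
      rcases mem_edges_or_kid (C := C) (T := T) h with h | h | h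
      · exact .inl (SimpleGraph.Walk.adj_toSubgraph_iff_mem_edges.2 h)
      · exact .inr h
      · exact absurd h (not_kid_of_mem_support hroot hc)
    · rintro (h | h)
      · exact hH.2 h
      · exact h.2.2
  rw [deg, h, Set.ncard_union_eq _ (Set.toFinite _) (Set.toFinite _), Set.ncard_coe_finset,
    hC.ncard_neighborSet_toSubgraph_eq_two hc]
  rw [Set.disjoint_left]
  intro w hw hk
  rw [Finset.mem_coe, RootedForest.mem_kids] at hk
  exact not_mem_edges_of_kid hk (SimpleGraph.Walk.adj_toSubgraph_iff_mem_edges.1 hw)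

theorem odd_deg_iff_of_mem_support (hC : C.IsCycle) (hroot : ∀ c ∈ C.support, T.depth c = 0)
    (hH : C.toSubgraph ≤ H) {c : V} (hc : c ∈ C.support) :
    Odd (deg H c) ↔ par (T.code H c) ≠ 0 := by
  rw [deg_of_mem_support hC hroot hH hc, RootedForest.par_code, Ne,
    ZMod.natCast_eq_zero_iff_even, Nat.not_even_iff_odd, Nat.odd_iff, Nat.odd_iff]
  omega

/-- The edge to the parent adds one to the number of children, whereas a cycle vertex has two
further edges; hence the opposite parity. -/
theorem odd_deg_iff_of_kid (hroot : ∀ c ∈ C.support, T.depth c = 0) {w v : V}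
    (hw : T.Kid H w v) : Odd (deg H w) ↔ par (T.code H w) = 0 := by
  classical
  have hwC := not_mem_support_of_kid hroot hw
  have h : H.neighborSet w = insert v (T.kids H w : Set V) := by
    ext x
    simp only [SimpleGraph.Subgraph.mem_neighborSet, Set.mem_insert_iff, Finset.mem_coe,
      RootedForest.mem_kids]
    constructor
    · intro h
      rcases mem_edges_or_kid (C := C) (T := T) h with h | h | h
      · exact absurd (C.fst_mem_support_of_mem_edges h) hwC
      · exact .inr h
      · exact .inl (h.unique hw)
    · rintro (rfl | h)
      · exact hw.2.2.symm
      · exact h.2.2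
  have hn : v ∉ (T.kids H w : Set V) := by
    rw [Finset.mem_coe, RootedForest.mem_kids]
    exact hw.not_symm
  rw [deg, h, Set.ncard_insert_of_notMem hn (Set.toFinite _), Set.ncard_coe_finset,
    RootedForest.par_code, ZMod.natCast_eq_zero_iff_even, Nat.odd_add_one, Nat.not_odd_iff_even]

theorem odd_deg_iff_of_below (hroot : ∀ c ∈ C.support, T.depth c = 0) {t v : V}
    (ht : T.Below H t v) (hne : t ≠ v) : Odd (deg H t) ↔ par (T.code H t) = 0 := by
  obtain ⟨w, hw, _⟩ := ht.eq_or_kid.resolve_left hne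
  exact odd_deg_iff_of_kid hroot hw

/-- Each edge off the cycle joins exactly one nonroot to its parent. -/
theorem ncard_edgeSet_eq (hC : C.IsCycle) (hH : C.toSubgraph ≤ H) :
    H.edgeSet.ncard = C.length + (T.nonroots H).card := by
  classical
  have hk : ∀ w ∈ T.nonroots H, T.Kid H w (T.parent w) := fun w hw => by
    obtain ⟨v, hv⟩ : ∃ v, T.Kid H w v := by simpa [RootedForest.nonroots] using hw
    rwa [hv.2.1]
  have h : H.edgeSet = (C.edges.toFinset : Set (Sym2 V)) ∪
      ((T.nonroots H).image fun w => s(T.parent w, w) : Finset (Sym2 V)) := by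
    ext e
    induction e with
    | _ a b =>
      simp only [Set.mem_union, Finset.mem_coe, List.mem_toFinset, Finset.mem_image,
        SimpleGraph.Subgraph.mem_edgeSet]
      constructor
      · intro h
        rcases mem_edges_or_kid (C := C) (T := T) h with h | h | h
        · exact .inl h
        · exact .inr ⟨b, by simpa [RootedForest.nonroots] using ⟨a, h⟩, by rw [h.2.1]⟩
        · exact .inr ⟨a, by simpa [RootedForest.nonroots] using ⟨b, h⟩,
            by rw [h.2.1, Sym2.eq_swap]⟩
      · rintro (h | ⟨w, hw, he⟩)
        · exact SimpleGraph.Subgraph.edgeSet_mono hH (C.mem_edges_toSubgraph.2 h)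
        · have : s(T.parent w, w) ∈ H.edgeSet := (hk w hw).2.2
          rw [he] at this
          exact this
  have hd : Disjoint (C.edges.toFinset : Set (Sym2 V))
      ((T.nonroots H).image fun w => s(T.parent w, w) : Finset (Sym2 V)) := by
    rw [Finset.disjoint_coe, Finset.disjoint_right]
    intro e he
    obtain ⟨w, hw, rfl⟩ := Finset.mem_image.1 he
    rw [List.mem_toFinset]
    exact not_mem_edges_of_kid (hk w hw)
  rw [h, Set.ncard_union_eq hd (Set.toFinite _) (Set.toFinite _), Set.ncard_coe_finset,
    Set.ncard_coe_finset, List.toFinset_card_of_nodup hC.isTrail.edges_nodup,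
    SimpleGraph.Walk.length_edges, Finset.card_image_of_injOn]
  intro w hw w' hw' he
  have hw := hk w hw
  have hw' := hk w' hw'
  simp only [Sym2.eq_iff] at he
  rcases he with h | h
  · exact h.2
  · have h1 := hw.depth_eq
    have h2 := hw'.depth_eq
    rw [h.1] at h1
    rw [← h.2] at h2
    omega

theorem code_deleteVerts_eq_of_ne {t r c : V} (hr : ∀ v, ¬ T.Kid H r v) (hc : ∀ v, ¬ T.Kid H c v)
    (h : T.Below H t r) (hne : c ≠ r) : T.code (H.deleteVerts {t}) c = T.code H c :=
  RootedForest.code_deleteVerts_of_not_below fun h' => hne (eq_of_below hr hc h h').symm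

theorem exists_odd_deg_of_mv (hroot : ∀ c ∈ C.support, T.depth c = 0) {r : V} {b : Code}
    (hr : r ∈ H.verts) (hb : Mv (T.code H r) b) :
    ∃ t ∈ H.verts, t ∉ C.support ∧ Odd (deg H t) ∧ T.Below H t r ∧ t ≠ r ∧
      T.code (H.deleteVerts {t}) r = T.code H r + b := by
  obtain ⟨t, ht, hne, hp, hcode⟩ := RootedForest.exists_below_of_mv hb rfl
  obtain ⟨w, hw, _⟩ := ht.eq_or_kid.resolve_left hne
  exact ⟨t, ht.mem_verts hr, not_mem_support_of_kid hroot hw,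
    (odd_deg_iff_of_kid hroot hw).2 hp, ht, hne, hcode⟩

/-! ### The three kinds of position -/

/-- All trees attached to the cycle cancel. -/
def AllZero (T : RootedForest (G.deleteEdges {e | e ∈ C.edges})) (H : G.Subgraph) : Prop :=
  ∀ c ∈ C.support, T.code H c = 0

/-- All but one of the trees attached to the cycle cancel, and that one has a bad code. -/
def OneBad (T : RootedForest (G.deleteEdges {e | e ∈ C.edges})) (H : G.Subgraph) : Prop :=
  ∃ A ∈ C.support, Bad (T.code H A) ∧ ∀ c ∈ C.support, c ≠ A → T.code H c = 0

/-- The description of the nim-value in terms of the codes of the attached trees. -/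
def Described (T : RootedForest (G.deleteEdges {e | e ∈ C.edges})) (H : G.Subgraph) : Prop :=
  (AllZero T H ∧ nimValue H = 3 - phi H) ∨ (OneBad T H ∧ 4 ≤ nimValue H) ∨
    (¬ AllZero T H ∧ ¬ OneBad T H ∧ nimValue H = phi H)

theorem OneBad.not_allZero (h : OneBad T H) : ¬ AllZero T H := by
  obtain ⟨A, hA, hb, _⟩ := h
  exact fun h0 => hb.ne_zero (h0 A hA)

theorem not_oneBad_of_two {a b : V} (ha : a ∈ C.support) (hb : b ∈ C.support) (hab : a ≠ b)
    (ha0 : T.code H a ≠ 0) (hb0 : T.code H b ≠ 0) : ¬ OneBad T H := by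
  rintro ⟨A, _, _, h⟩
  have h1 : a = A := by by_contra hc; exact ha0 (h a ha hc)
  have h2 : b = A := by by_contra hc; exact hb0 (h b hb hc)
  exact hab (h1.trans h2.symm)

theorem Described.nimValue_eq_phi (h : Described T H) (h1 : ¬ AllZero T H) (h2 : ¬ OneBad T H) :
    nimValue H = phi H := by
  rcases h with h | h | h
  · exact absurd h.1 h1
  · exact absurd h.1 h2
  · exact h.2.2

theorem Described.nimValue_of_allZero (h : Described T H) (h1 : AllZero T H) :
    nimValue H = 3 - phi H := by
  rcases h with h | h | h
  · exact h.2
  · exact absurd h1 h.1.not_allZero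
  · exact absurd h1 h.1

/-- Deleting a vertex of odd degree changes the code of at most one attached tree, and does so by a
bad code. -/
theorem exists_change {t : V} (hroot : ∀ c ∈ C.support, T.depth c = 0) (htC : t ∉ C.support)
    (hodd : Odd (deg H t)) {A : V} (hA : A ∈ C.support)
    (h : T.code (H.deleteVerts {t}) A ≠ T.code H A) :
    Bad (T.code H A + T.code (H.deleteVerts {t}) A) ∧
      ∀ c ∈ C.support, c ≠ A → T.code (H.deleteVerts {t}) c = T.code H c := by
  have hb : T.Below H t A := by
    by_contra hc
    exact h (RootedForest.code_deleteVerts_of_not_below hc)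
  have hne : t ≠ A := by rintro rfl; exact htC hA
  refine ⟨(RootedForest.code_deleteVerts_bad ((odd_deg_iff_of_below hroot hb hne).1 hodd) hb
    hne).resolve_left h, fun c hc hcA => ?_⟩
  exact code_deleteVerts_eq_of_ne (fun v => not_kid_of_mem_support hroot hA)
    (fun v => not_kid_of_mem_support hroot hc) hb hcA

/-- The one code that becomes zero equals its own change, which is bad. -/
theorem oneBad_of_allZero_deleteVerts {t : V} (hroot : ∀ c ∈ C.support, T.depth c = 0)
    (htC : t ∉ C.support) (hodd : Odd (deg H t)) (h : AllZero T (H.deleteVerts {t}))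
    (h' : ¬ AllZero T H) : OneBad T H := by
  simp only [AllZero, not_forall] at h'
  obtain ⟨A, hA, h0⟩ := h'
  obtain ⟨h1, h2⟩ := exists_change hroot htC hodd hA (by rw [h A hA]; exact Ne.symm h0)
  rw [h A hA, add_zero] at h1
  exact ⟨A, hA, h1, fun c hc hne => by rw [← h2 c hc hne, h c hc]⟩

theorem oneBad_deleteVerts_of_allZero {t : V} (hroot : ∀ c ∈ C.support, T.depth c = 0)
    (htC : t ∉ C.support) (hodd : Odd (deg H t)) (h : AllZero T H)
    (h' : ¬ AllZero T (H.deleteVerts {t})) : OneBad T (H.deleteVerts {t}) := by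
  simp only [AllZero, not_forall] at h'
  obtain ⟨A, hA, h0⟩ := h'
  obtain ⟨h1, h2⟩ := exists_change hroot htC hodd hA (by rw [h A hA]; exact h0)
  rw [h A hA, zero_add] at h1
  exact ⟨A, hA, h1, fun c hc hne => by rw [h2 c hc hne, h c hc]⟩

/-- Below a root that is not on the cycle and has a nonzero code, there is a vertex of odd degree
whose deletion does not affect the trees attached to the cycle. -/
theorem exists_odd_deg_of_root (hroot : ∀ c ∈ C.support, T.depth c = 0) {r : V}
    (hrC : r ∉ C.support) (hr : ∀ v, ¬ T.Kid H r v) (h0 : T.code H r ≠ 0) :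
    ∃ t ∈ H.verts, t ∉ C.support ∧ Odd (deg H t) ∧
      ∀ c ∈ C.support, T.code (H.deleteVerts {t}) c = T.code H c := by
  have hrH : r ∈ H.verts := by
    by_contra hc
    apply h0
    rw [RootedForest.code_eq]
    exact Finset.sum_eq_zero fun w hw => absurd (RootedForest.mem_kids.1 hw).2.2.fst_mem hc
  obtain ⟨b, hb⟩ := exists_mv h0
  obtain ⟨t, ht, htC, hodd, hbel, -, -⟩ := exists_odd_deg_of_mv hroot hrH hb
  exact ⟨t, ht, htC, hodd, fun c hc => code_deleteVerts_eq_of_ne hr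
    (fun v => not_kid_of_mem_support hroot hc) hbel (by rintro rfl; exact hrC hc)⟩

theorem not_mem_nonroots {r : V} : r ∉ T.nonroots H ↔ ∀ v, ¬ T.Kid H r v := by
  simp [RootedForest.nonroots]

theorem nimValue_deleteVerts_of_mem_support
    (hone : ∀ (w : V) (D : G.Walk w w), D.IsCycle → D.toSubgraph = C.toSubgraph)
    {c : V} (hc : c ∈ C.support) :
    nimValue (H.deleteVerts {c}) = phi (H.deleteVerts {c}) := by
  refine nimValue_eq_phi_of_colorable (colorable_of_not_le hone fun h => ?_)
  have := h.1 (C.mem_verts_toSubgraph.2 hc)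
  simp at this

theorem nimValue_deleteEdges_of_mem_edges
    (hone : ∀ (w : V) (D : G.Walk w w), D.IsCycle → D.toSubgraph = C.toSubgraph)
    {e : Sym2 V} (he : e ∈ C.edges) :
    nimValue (H.deleteEdges {e}) = phi (H.deleteEdges {e}) :=
  nimValue_eq_phi_of_colorable (colorable_of_not_le hone (not_toSubgraph_le_deleteEdges he))

end Unicyclic

end GraphTakeaway

namespace GraphTakeaway

variable {V : Type*} {G : SimpleGraph V}

/-! ### The nim-value of positions that contain the cycle -/

section Induction

variable {u : V} {C : G.Walk u u} {H : G.Subgraph}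
  {T : RootedForest (G.deleteEdges {e | e ∈ C.edges})}

/-- The move that a vertex deletion or an edge deletion makes, if the cycle survives. -/
theorem isMove_cases (hH : C.toSubgraph ≤ H) {K : G.Subgraph} (hK : IsMove H K) :
    (C.toSubgraph ≤ K ∧ ((∃ v ∈ H.verts, v ∉ C.support ∧ K = H.deleteVerts {v}) ∨
      ∃ e ∈ H.edgeSet, K = H.deleteEdges {e})) ∨
    (¬ C.toSubgraph ≤ K ∧ ((∃ v ∈ C.support, K = H.deleteVerts {v}) ∨
      ∃ e ∈ C.edges, K = H.deleteEdges {e})) := by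
  rcases hK with ⟨v, hv, rfl⟩ | ⟨e, he, rfl⟩
  · by_cases hvC : v ∈ C.support
    · refine .inr ⟨fun h => ?_, .inl ⟨v, hvC, rfl⟩⟩
      exact (toSubgraph_le_deleteVerts_iff hH _).1 h v hvC rfl
    · refine .inl ⟨(toSubgraph_le_deleteVerts_iff hH _).2 fun c hc h => ?_, .inl ⟨v, hv, hvC, rfl⟩⟩
      rw [Set.mem_singleton_iff] at h
      exact hvC (h ▸ hc)
  · by_cases heC : e ∈ C.edges
    · exact .inr ⟨not_toSubgraph_le_deleteEdges heC, .inr ⟨e, heC, rfl⟩⟩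
    · exact .inl ⟨toSubgraph_le_deleteEdges hH heC, .inr ⟨e, he, rfl⟩⟩

theorem toSubgraph_le_deleteVerts (hH : C.toSubgraph ≤ H) {t : V} (ht : t ∉ C.support) :
    C.toSubgraph ≤ H.deleteVerts {t} := by
  refine (toSubgraph_le_deleteVerts_iff hH _).2 fun c hc h => ht ?_
  rw [Set.mem_singleton_iff] at h
  exact h ▸ hc

variable [Fintype V]

-- The cycle has an odd number of edges, and the codes of the roots count the others.
open Classical in
theorem sum_edgeParity_eq_zero_iff (hC : C.IsCycle) (hodd : Odd C.length)
    (hH : C.toSubgraph ≤ H) :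
    ∑ v ∈ (T.nonroots H)ᶜ, edgeParity (T.code H v) = 0 ↔ Odd H.edgeSet.ncard := by
  rw [ncard_edgeSet_eq (T := T) hC hH, ← RootedForest.card_nonroots_eq,
    ZMod.natCast_eq_zero_iff_even, Nat.odd_add]
  simp [hodd]

variable (hC : C.IsCycle) (hodd : Odd C.length)
    (hone : ∀ (w : V) (D : G.Walk w w), D.IsCycle → D.toSubgraph = C.toSubgraph)
    (hroot : ∀ c ∈ C.support, T.depth c = 0) (hH : C.toSubgraph ≤ H)

include hC hone hH in
theorem exists_move_edge :
    ∃ K, IsMove H K ∧ nimValue K = H.verts.ncard % 2 + 2 * (1 - H.edgeSet.ncard % 2) := by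
  obtain ⟨e, he⟩ := exists_mem_edges hC
  have heH : e ∈ H.edgeSet := SimpleGraph.Subgraph.edgeSet_mono hH (C.mem_edges_toSubgraph.2 he)
  exact ⟨_, isMove_deleteEdges heH, by
    rw [nimValue_deleteEdges_of_mem_edges hone he, phi_deleteEdges heH]⟩

include hC hone hroot hH in
theorem exists_move_cycle_even {c : V} (hc : c ∈ C.support) (hp : par (T.code H c) = 0) :
    ∃ K, IsMove H K ∧ nimValue K = (1 - H.verts.ncard % 2) + 2 * (H.edgeSet.ncard % 2) := by
  have hcH := mem_verts_of_mem_support hH hc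
  have hd : Even (deg H c) := by
    rw [← Nat.not_odd_iff_even, odd_deg_iff_of_mem_support hC hroot hH hc]
    exact not_not.2 hp
  exact ⟨_, isMove_deleteVerts hcH, by
    rw [nimValue_deleteVerts_of_mem_support hone hc, phi_deleteVerts_even hcH hd]⟩

include hC hone hroot hH in
theorem exists_move_cycle_odd {c : V} (hc : c ∈ C.support) (hp : par (T.code H c) ≠ 0) :
    ∃ K, IsMove H K ∧ nimValue K = (1 - H.verts.ncard % 2) + 2 * (1 - H.edgeSet.ncard % 2) := by
  have hcH := mem_verts_of_mem_support hH hc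
  have hd := (odd_deg_iff_of_mem_support hC hroot hH hc).2 hp
  exact ⟨_, isMove_deleteVerts hcH, by
    rw [nimValue_deleteVerts_of_mem_support hone hc, phi_deleteVerts_odd hcH hd]⟩

variable (ih : ∀ K, IsMove H K → C.toSubgraph ≤ K → Described T K)

include hH ih in
theorem exists_move_odd_good {t : V} (htH : t ∈ H.verts) (htC : t ∉ C.support)
    (hd : Odd (deg H t)) (h1 : ¬ AllZero T (H.deleteVerts {t}))
    (h2 : ¬ OneBad T (H.deleteVerts {t})) :
    ∃ K, IsMove H K ∧ nimValue K = (1 - H.verts.ncard % 2) + 2 * (1 - H.edgeSet.ncard % 2) :=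
  ⟨_, isMove_deleteVerts htH, by
    rw [(ih _ (isMove_deleteVerts htH) (toSubgraph_le_deleteVerts hH htC)).nimValue_eq_phi h1 h2,
      phi_deleteVerts_odd htH hd]⟩

include hH ih in
theorem exists_move_odd_allZero {t : V} (htH : t ∈ H.verts) (htC : t ∉ C.support)
    (hd : Odd (deg H t)) (h1 : AllZero T (H.deleteVerts {t})) :
    ∃ K, IsMove H K ∧ nimValue K = phi H :=
  ⟨_, isMove_deleteVerts htH, by
    rw [(ih _ (isMove_deleteVerts htH) (toSubgraph_le_deleteVerts hH htC)).nimValue_of_allZero h1,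
      phi_deleteVerts_odd htH hd, phi]
    omega⟩

include hroot hC hodd hH in
/-- If the parity of the edges is right, a tree apart from the cycle has a vertex of odd degree. -/
theorem exists_root_of_allZero (h : AllZero T H) (hm : H.edgeSet.ncard % 2 = 0) :
    ∃ t ∈ H.verts, t ∉ C.support ∧ Odd (deg H t) ∧ AllZero T (H.deleteVerts {t}) := by
  classical
  obtain ⟨r, hr, h0⟩ : ∃ r ∈ (T.nonroots H)ᶜ, edgeParity (T.code H r) ≠ 0 := by
    by_contra! hc
    have := (sum_edgeParity_eq_zero_iff (T := T) hC hodd hH).1 (Finset.sum_eq_zero hc)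
    rw [Nat.odd_iff] at this
    omega
  have hr0 : T.code H r ≠ 0 := fun e => h0 (by rw [e, map_zero])
  obtain ⟨t, htH, htC, hd, hcode⟩ := exists_odd_deg_of_root hroot (fun hrC => hr0 (h r hrC))
    (not_mem_nonroots.1 (Finset.mem_compl.1 hr)) hr0
  exact ⟨t, htH, htC, hd, fun c hc => by rw [hcode c hc, h c hc]⟩

-- To attain `3 - phi H`, an option of value `phi` must flip both bits. Cycle vertices have even
-- degree here, and deleting another vertex of odd degree gives zero codes again or value at least
-- 4.
include hC hodd hone hroot hH ih in
theorem nimValue_of_allZero (h : AllZero T H) : nimValue H = 3 - phi H := by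
  have hn := Nat.mod_two_eq_zero_or_one H.verts.ncard
  have hm := Nat.mod_two_eq_zero_or_one H.edgeSet.ncard
  refine nimValue_eq (fun K hK hKn => ?_) fun j hj => ?_
  · rcases isMove_cases hH hK with ⟨hCK, hcase⟩ | ⟨-, ⟨v, hv, rfl⟩ | ⟨e, he, rfl⟩⟩
    · have hne := phi_ne_of_isMove hK
      have h3 := phi_le K
      have h3' := phi_le H
      rcases ih K hK hCK with h' | h' | h'
      · omega
      · omega
      · rcases hcase with ⟨v, hvH, hvC, rfl⟩ | ⟨e, he, rfl⟩
        · rcases Nat.even_or_odd (deg H v) with hd | hd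
          · have := phi_deleteVerts_even hvH hd
            rw [h'.2.2, this, phi] at hKn
            omega
          · exact h'.2.1 (oneBad_deleteVerts_of_allZero hroot hvC hd h h'.1)
        · have := phi_deleteEdges he
          rw [h'.2.2, this, phi] at hKn
          omega
    · have hvH := mem_verts_of_mem_support hH hv
      have hd : Even (deg H v) := by
        rw [← Nat.not_odd_iff_even, odd_deg_iff_of_mem_support hC hroot hH hv, h v hv]
        simp
      rw [nimValue_deleteVerts_of_mem_support hone hv, phi_deleteVerts_even hvH hd, phi] at hKn
      omega
    · have heH := SimpleGraph.Subgraph.edgeSet_mono hH (C.mem_edges_toSubgraph.2 he)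
      rw [nimValue_deleteEdges_of_mem_edges hone he, phi_deleteEdges heH, phi] at hKn
      omega
  · have hE := exists_move_edge hC hone hH
    have hV := exists_move_cycle_even hC hone hroot hH C.start_mem_support
      (by rw [h u C.start_mem_support, map_zero])
    -- The value `phi H` lies below `3 - phi H` only if the edge bit is 0. Deleting a vertex of odd
    -- degree while all codes stay zero flips both bits twice, which gives `phi H`.
    have hO : H.edgeSet.ncard % 2 = 0 → ∃ K, IsMove H K ∧ nimValue K = phi H := fun hm => by
      obtain ⟨t, htH, htC, hd, h1⟩ := exists_root_of_allZero hC hodd hroot hH h hm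
      exact exists_move_odd_allZero hH ih htH htC hd h1
    rw [phi] at hj hO
    have hj' : j = H.verts.ncard % 2 + 2 * (1 - H.edgeSet.ncard % 2) ∨
        j = (1 - H.verts.ncard % 2) + 2 * (H.edgeSet.ncard % 2) ∨
        (H.edgeSet.ncard % 2 = 0 ∧ j = H.verts.ncard % 2 + 2 * (H.edgeSet.ncard % 2)) := by
      clear hE hV hO
      omega
    rcases hj' with rfl | rfl | ⟨h, rfl⟩
    · exact hE
    · exact hV
    · exact hO h

include hC hone hroot hH ih in
theorem le_nimValue_of_oneBad (h : OneBad T H) : 4 ≤ nimValue H := by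
  have hn := Nat.mod_two_eq_zero_or_one H.verts.ncard
  have hm := Nat.mod_two_eq_zero_or_one H.edgeSet.ncard
  obtain ⟨A, hA, hbad, hz⟩ := h
  have hAH := mem_verts_of_mem_support hH hA
  have hAr : ∀ v, ¬ T.Kid H A v := fun v => not_kid_of_mem_support hroot hA
  have hcr : ∀ c ∈ C.support, ∀ v, ¬ T.Kid H c v := fun c hc v => not_kid_of_mem_support hroot hc
  -- Annihilating the bad code leads to a position with all codes zero.
  have h0 : ∃ K, IsMove H K ∧ nimValue K = phi H := by
    obtain ⟨t, htH, htC, hd, hbel, hne, hcode⟩ := exists_odd_deg_of_mv hroot hAH hbad.mv_self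
    refine exists_move_odd_allZero hH ih htH htC hd fun c hc => ?_
    by_cases hcA : c = A
    · rw [hcA, hcode, Code.add_self]
    · rw [code_deleteVerts_eq_of_ne hAr (hcr c hc) hbel hcA, hz c hc hcA]
  have hE := exists_move_edge hC hone hH
  have hV : ∃ K, IsMove H K ∧
      nimValue K = (1 - H.verts.ncard % 2) + 2 * (H.edgeSet.ncard % 2) := by
    obtain ⟨a, ha, b, hb, -, -, hab, -⟩ := exists_three_mem_support hC
    by_cases haA : a = A
    · exact exists_move_cycle_even hC hone hroot hH hb
        (by rw [hz b hb (fun e => hab (haA.trans e.symm)), map_zero])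
    · exact exists_move_cycle_even hC hone hroot hH ha (by rw [hz a ha haA, map_zero])
  -- Both bits flip by deleting `A` if its degree is odd, and otherwise by a move to a code that is
  -- neither zero nor bad.
  have hO : ∃ K, IsMove H K ∧
      nimValue K = (1 - H.verts.ncard % 2) + 2 * (1 - H.edgeSet.ncard % 2) := by
    by_cases hp : par (T.code H A) = 0
    · obtain ⟨b, hb, hne0, hnb⟩ := hbad.exists_mv hp
      obtain ⟨t, htH, htC, hd, hbel, hne, hcode⟩ := exists_odd_deg_of_mv hroot hAH hb
      refine exists_move_odd_good hH ih htH htC hd (fun h => hne0 (hcode ▸ h A hA)) ?_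
      rintro ⟨B, hB, hBb, -⟩
      by_cases hBA : B = A
      · rw [hBA, hcode] at hBb; exact hnb hBb
      · rw [code_deleteVerts_eq_of_ne hAr (hcr B hB) hbel hBA, hz B hB hBA] at hBb
        exact hBb.ne_zero rfl
    · exact exists_move_cycle_odd hC hone hroot hH hA hp
  refine le_nimValue fun j hj => ?_
  rw [phi] at h0
  have hj' : j = H.verts.ncard % 2 + 2 * (H.edgeSet.ncard % 2) ∨
      j = H.verts.ncard % 2 + 2 * (1 - H.edgeSet.ncard % 2) ∨
      j = (1 - H.verts.ncard % 2) + 2 * (H.edgeSet.ncard % 2) ∨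
      j = (1 - H.verts.ncard % 2) + 2 * (1 - H.edgeSet.ncard % 2) := by omega
  rcases hj' with rfl | rfl | rfl | rfl
  · exact h0
  · exact hE
  · exact hV
  · exact hO

include hC hone hroot hH ih in
theorem exists_move_even (hn : H.verts.ncard % 2 = 1) :
    ∃ K, IsMove H K ∧ nimValue K = (1 - H.verts.ncard % 2) + 2 * (H.edgeSet.ncard % 2) := by
  by_cases hc : ∃ c ∈ C.support, par (T.code H c) = 0
  · obtain ⟨c, hc, hp⟩ := hc
    exact exists_move_cycle_even hC hone hroot hH hc hp
  push Not at hc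
  have h0 : ∀ c ∈ C.support, T.code H c ≠ 0 := fun c hcC e => hc c hcC (by rw [e, map_zero])
  obtain ⟨v, hvH, hd⟩ := exists_even_deg (Nat.odd_iff.2 hn)
  have hvC : v ∉ C.support := fun hvC =>
    (Nat.not_odd_iff_even.2 hd) ((odd_deg_iff_of_mem_support hC hroot hH hvC).2 (hc v hvC))
  -- Deleting `v` alters at most one attached tree and the cycle has at least three vertices, so two
  -- nonzero codes survive.
  obtain ⟨a, b, ha, hb, hab, ha0, hb0⟩ : ∃ a b, a ∈ C.support ∧ b ∈ C.support ∧ a ≠ b ∧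
      T.code (H.deleteVerts {v}) a ≠ 0 ∧ T.code (H.deleteVerts {v}) b ≠ 0 := by
    have hu : ∀ a ∈ C.support, ∀ b ∈ C.support, a ≠ b →
        T.code (H.deleteVerts {v}) a ≠ 0 ∨ T.code (H.deleteVerts {v}) b ≠ 0 := by
      intro a ha b hb hab
      by_cases hba : T.Below H v a
      · right
        rw [code_deleteVerts_eq_of_ne (fun w => not_kid_of_mem_support hroot ha)
          (fun w => not_kid_of_mem_support hroot hb) hba hab.symm]
        exact h0 b hb
      · left
        rw [RootedForest.code_deleteVerts_of_not_below hba]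
        exact h0 a ha
    obtain ⟨a, ha, b, hb, c, hc, hab, hac, hbc⟩ := exists_three_mem_support hC
    have h1 := hu a ha b hb hab
    have h2 := hu a ha c hc hac
    have h3 := hu b hb c hc hbc
    by_cases h4 : T.code (H.deleteVerts {v}) a ≠ 0
    · rcases h3 with h3 | h3
      · exact ⟨a, b, ha, hb, hab, h4, h3⟩
      · exact ⟨a, c, ha, hc, hac, h4, h3⟩
    · exact ⟨b, c, hb, hc, hbc, h1.resolve_left h4, h2.resolve_left h4⟩
  refine ⟨_, isMove_deleteVerts hvH, ?_⟩
  rw [(ih _ (isMove_deleteVerts hvH) (toSubgraph_le_deleteVerts hH hvC)).nimValue_eq_phi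
    (fun h => ha0 (h a ha)) (not_oneBad_of_two ha hb hab ha0 hb0), phi_deleteVerts_even hvH hd]

include hC hodd hone hroot hH ih in
theorem exists_move_odd (h1 : ¬ AllZero T H) (h2 : ¬ OneBad T H) (hm : H.edgeSet.ncard % 2 = 1) :
    ∃ K, IsMove H K ∧ nimValue K = (1 - H.verts.ncard % 2) + 2 * (1 - H.edgeSet.ncard % 2) := by
  classical
  by_cases hc : ∃ c ∈ C.support, par (T.code H c) ≠ 0
  · obtain ⟨c, hc, hp⟩ := hc
    exact exists_move_cycle_odd hC hone hroot hH hc hp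
  push Not at hc
  -- All cycle vertices now have even degree, so the vertex is sought off the cycle. In a component
  -- apart from the cycle, its deletion leaves the attached codes alone.
  by_cases hr : ∃ r, r ∉ C.support ∧ (∀ v, ¬ T.Kid H r v) ∧ T.code H r ≠ 0
  · obtain ⟨r, hrC, hr, h0⟩ := hr
    obtain ⟨t, htH, htC, hd, hcode⟩ := exists_odd_deg_of_root hroot hrC hr h0
    refine exists_move_odd_good hH ih htH htC hd
      (fun h => h1 fun c hc => by rw [← hcode c hc, h c hc]) ?_
    rintro ⟨A, hA, hb, hz⟩
    exact h2 ⟨A, hA, by rwa [← hcode A hA], fun c hc hne => by rw [← hcode c hc, hz c hc hne]⟩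
  push Not at hr
  obtain ⟨A, hA, hA0⟩ : ∃ A ∈ C.support, T.code H A ≠ 0 := by simpa [AllZero] using h1
  have hAH := mem_verts_of_mem_support hH hA
  have hAr : ∀ v, ¬ T.Kid H A v := fun v => not_kid_of_mem_support hroot hA
  have hcr : ∀ c ∈ C.support, ∀ v, ¬ T.Kid H c v := fun c hc v => not_kid_of_mem_support hroot hc
  -- With a second nonzero code, it is enough to keep the code at `A` nonzero.
  by_cases hB : ∃ B ∈ C.support, B ≠ A ∧ T.code H B ≠ 0
  · obtain ⟨B, hB, hBA, hB0⟩ := hB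
    obtain ⟨b, hb, hne0⟩ := exists_mv_add_ne_zero hA0 (hc A hA)
    obtain ⟨t, htH, htC, hd, hbel, hne, hcode⟩ := exists_odd_deg_of_mv hroot hAH hb
    have hA' : T.code (H.deleteVerts {t}) A ≠ 0 := by rwa [hcode]
    have hB' : T.code (H.deleteVerts {t}) B ≠ 0 := by
      rwa [code_deleteVerts_eq_of_ne hAr (hcr B hB) hbel hBA]
    exact exists_move_odd_good hH ih htH htC hd (fun h => hA' (h A hA))
      (not_oneBad_of_two hA hB hBA.symm hA' hB')
  push Not at hB
  have he : edgeParity (T.code H A) = 0 := by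
    rw [← (sum_edgeParity_eq_zero_iff (T := T) hC hodd hH).2 (Nat.odd_iff.2 hm)]
    refine (Finset.sum_eq_single_of_mem (f := fun v => edgeParity (T.code H v)) A ?_
      fun r hr' hrA => ?_).symm
    · exact Finset.mem_compl.2 (not_mem_nonroots.2 hAr)
    · by_cases hrC : r ∈ C.support
      · rw [hB r hrC hrA, map_zero]
      · rw [hr r hrC (not_mem_nonroots.1 (Finset.mem_compl.1 hr')), map_zero]
  have hAb : ¬ Bad (T.code H A) := fun hb => h2 ⟨A, hA, hb, hB⟩
  obtain ⟨b, hb, hne0, hnb⟩ := exists_mv_not_bad hA0 (hc A hA) he hAb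
  obtain ⟨t, htH, htC, hd, hbel, hne, hcode⟩ := exists_odd_deg_of_mv hroot hAH hb
  refine exists_move_odd_good hH ih htH htC hd (fun h => hne0 (hcode ▸ h A hA)) ?_
  rintro ⟨B, hB', hBb, -⟩
  by_cases hBA : B = A
  · rw [hBA, hcode] at hBb; exact hnb hBb
  · rw [code_deleteVerts_eq_of_ne hAr (hcr B hB') hbel hBA, hB B hB' hBA] at hBb
    exact hBb.ne_zero rfl

-- Only an option with all codes zero and both bits flipped could have value `phi H`; it would arise
-- from a deletion of odd degree, making `H` itself `OneBad`.
include hC hodd hone hroot hH ih in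
theorem nimValue_of_good (h1 : ¬ AllZero T H) (h2 : ¬ OneBad T H) : nimValue H = phi H := by
  have hn := Nat.mod_two_eq_zero_or_one H.verts.ncard
  have hm := Nat.mod_two_eq_zero_or_one H.edgeSet.ncard
  refine nimValue_eq (fun K hK hKn => ?_) fun j hj => ?_
  · have hne := phi_ne_of_isMove hK
    have h3 := phi_le H
    rcases isMove_cases hH hK with ⟨hCK, hcase⟩ | ⟨hCK, -⟩
    · rcases ih K hK hCK with h' | h' | h'
      · have hK3 := h'.2.symm.trans hKn
        rcases hcase with ⟨v, hvH, hvC, rfl⟩ | ⟨e, he, rfl⟩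
        · rcases Nat.even_or_odd (deg H v) with hd | hd
          · rw [phi_deleteVerts_even hvH hd, phi] at hK3
            omega
          · exact h2 (oneBad_of_allZero_deleteVerts hroot hvC hd h'.1 h1)
        · rw [phi_deleteEdges he, phi] at hK3
          omega
      · omega
      · omega
    · rw [nimValue_eq_phi_of_colorable (colorable_of_not_le hone hCK)] at hKn
      exact hne hKn
  · have hE := exists_move_edge hC hone hH
    have hV := exists_move_even hC hone hroot hH ih
    have hO := exists_move_odd hC hodd hone hroot hH ih h1 h2
    rw [phi] at hj
    have hj' : j = H.verts.ncard % 2 + 2 * (1 - H.edgeSet.ncard % 2) ∨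
        (H.verts.ncard % 2 = 1 ∧ j = (1 - H.verts.ncard % 2) + 2 * (H.edgeSet.ncard % 2)) ∨
        (H.edgeSet.ncard % 2 = 1 ∧
          j = (1 - H.verts.ncard % 2) + 2 * (1 - H.edgeSet.ncard % 2)) := by
      clear hE hV hO
      omega
    rcases hj' with rfl | ⟨h, rfl⟩ | ⟨h, rfl⟩
    · exact hE
    · exact hV h
    · exact hO h

end Induction

theorem described {V : Type*} [Fintype V] {G : SimpleGraph V} {u : V} {C : G.Walk u u}
    (hC : C.IsCycle) (hodd : Odd C.length)
    (hone : ∀ (w : V) (D : G.Walk w w), D.IsCycle → D.toSubgraph = C.toSubgraph)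
    {T : RootedForest (G.deleteEdges {e | e ∈ C.edges})}
    (hroot : ∀ c ∈ C.support, T.depth c = 0) {H : G.Subgraph} (hH : C.toSubgraph ≤ H) :
    Described T H := by
  induction H using (wellFounded_lt (α := G.Subgraph)).induction with
  | _ H ih =>
    have ih' : ∀ K, IsMove H K → C.toSubgraph ≤ K → Described T K := fun K hK => ih K hK.lt
    by_cases h1 : AllZero T H
    · exact .inl ⟨h1, nimValue_of_allZero hC hodd hone hroot hH ih' h1⟩
    · by_cases h2 : OneBad T H
      · exact .inr (.inl ⟨h2, le_nimValue_of_oneBad hC hone hroot hH ih' h2⟩)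
      · exact .inr (.inr ⟨h1, h2, nimValue_of_good hC hodd hone hroot hH ih' h1 h2⟩)

/-- The nim-value differs from the parity function if and only if all trees attached to the cycle
cancel, or all but one do and the remaining one has a bad code. -/
theorem nimValue_ne_phi_iff {V : Type*} [Fintype V] {G : SimpleGraph V} {u : V} {C : G.Walk u u}
    (hC : C.IsCycle) (hodd : Odd C.length)
    (hone : ∀ (w : V) (D : G.Walk w w), D.IsCycle → D.toSubgraph = C.toSubgraph)
    {T : RootedForest (G.deleteEdges {e | e ∈ C.edges})}
    (hroot : ∀ c ∈ C.support, T.depth c = 0) {H : G.Subgraph} (hH : C.toSubgraph ≤ H) :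
    nimValue H ≠ phi H ↔ AllZero T H ∨ OneBad T H := by
  have h3 := phi_le H
  rcases described hC hodd hone hroot hH with h | h | h
  · have : nimValue H ≠ phi H := by omega
    simp [this, h.1]
  · have : nimValue H ≠ phi H := by omega
    simp [this, h.1]
  · simp [h]

end GraphTakeaway

namespace GraphTakeaway

variable {V : Type*} {G : SimpleGraph V}

/-! ### Reduced positions -/

section Reduced

variable {u : V} {C : G.Walk u u} {H : G.Subgraph}
  {T : RootedForest (G.deleteEdges {e | e ∈ C.edges})}

theorem not_mem_support_of_below (hroot : ∀ c ∈ C.support, T.depth c = 0) {x w v : V}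
    (hw : T.Kid H w v) (hx : T.Below H x w) : x ∉ C.support := by
  rcases hx.eq_or_kid with rfl | ⟨y, hy, _⟩
  · exact not_mem_support_of_kid hroot hw
  · exact not_mem_support_of_kid hroot hy

variable [Fintype V]

/-- The children of `x` have different codes. -/
def KidsInj (T : RootedForest (G.deleteEdges {e | e ∈ C.edges})) (H : G.Subgraph) (x : V) : Prop :=
  ∀ a b, T.Kid H a x → T.Kid H b x → T.code H a = T.code H b → a = b

theorem KidsInj.apply_code_ne_zero {x y : V} (h : KidsInj T H x) (hy : T.Kid H y x) :
    T.code H x (enc (T.code H y)) ≠ 0 := by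
  rw [RootedForest.code_eq, Finsupp.finsetSum_apply,
    Finset.sum_eq_single_of_mem y (RootedForest.mem_kids.2 hy), sing_apply_self]
  · decide
  · intro z hz hne
    exact sing_apply_of_ne fun e => hne (h z y (RootedForest.mem_kids.1 hz) hy e)

/-- The vertices below `w` and below `w'` that correspond to each other, when `w` and `w'` have the
same code. -/
inductive Match (T : RootedForest (G.deleteEdges {e | e ∈ C.edges})) (H : G.Subgraph) (w w' : V) :
    V → V → Prop
  | base : Match T H w w' w w'
  | step {x y x' y' : V} : Match T H w w' x y → T.Kid H x' x → T.Kid H y' y →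
      T.code H x' = T.code H y' → Match T H w w' x' y'

namespace Match

variable {w w' : V}

theorem symm {x y : V} (h : Match T H w w' x y) : Match T H w' w y x := by
  induction h with
  | base => exact .base
  | step _ hx hy hc ih => exact .step ih hy hx hc.symm

theorem isBelow {x y : V} (h : Match T H w w' x y) : T.Below H x w := by
  induction h with
  | base => exact .refl
  | step _ hx _ _ ih => exact .head hx ih

theorem code_eq (hcode : T.code H w = T.code H w') {x y : V} (h : Match T H w w' x y) :
    T.code H x = T.code H y := by
  cases h with
  | base => exact hcode
  | step _ _ _ hc => exact hc

/-- Siblings below `w` have different codes, so the code of a child of `x` does not cancel in the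
code of `x`; it therefore also occurs among the children of the partner of `x`. -/
theorem exists_of_below (hcode : T.code H w = T.code H w')
    (hinj : ∀ x, T.Below H x w → KidsInj T H x) {x : V} (hx : T.Below H x w) :
    ∃ y, Match T H w w' x y := by
  induction hx using Relation.ReflTransGen.head_induction_on with
  | refl => exact ⟨w', .base⟩
  | head hk hb ih =>
    obtain ⟨y, hy⟩ := ih
    have h1 := (hinj _ hb).apply_code_ne_zero hk
    rw [hy.code_eq hcode] at h1
    obtain ⟨y', hy', hc⟩ := RootedForest.exists_kid_of_mem h1
    exact ⟨y', .step hy hk hy' hc.symm⟩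

theorem unique (hinj : ∀ x, T.Below H x w' → KidsInj T H x) {x y y' : V}
    (h : Match T H w w' x y) (h' : Match T H w w' x y') : y = y' := by
  induction h generalizing y' with
  | base =>
    cases h' with
    | base => rfl
    | step h hk _ _ =>
      have := h.isBelow.depth_le
      have := hk.depth_eq
      omega
  | @step x₀ y₀ x₁ y₁ h hk hk' hc ih =>
    cases h' with
    | base =>
      have := h.isBelow.depth_le
      have := hk.depth_eq
      omega
    | step h2 hk2 hk2' hc2 =>
      cases hk.unique hk2
      cases ih h2
      exact hinj _ h.symm.isBelow _ _ hk' hk2' (hc.symm.trans hc2)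

theorem kid (hinj : ∀ x, T.Below H x w' → KidsInj T H x) {x y x' y' : V}
    (h : Match T H w w' x y) (h' : Match T H w w' x' y') (hk : T.Kid H x' x) : T.Kid H y' y := by
  cases h' with
  | base =>
    have := h.isBelow.depth_le
    have := hk.depth_eq
    omega
  | step h2 hk2 hk2' _ =>
    cases hk.unique hk2
    cases h.unique hinj h2
    exact hk2'

end Match

theorem Match.adj (hroot : ∀ c ∈ C.support, T.depth c = 0) {w w' v : V} (hw : T.Kid H w v)
    (hinj : ∀ x, T.Below H x w' → KidsInj T H x) {x y x' y' : V}
    (h : Match T H w w' x y) (h' : Match T H w w' x' y') (ha : H.Adj x x') : H.Adj y y' := by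
  rcases mem_edges_or_kid (C := C) (T := T) ha with he | hk | hk
  · exact absurd (C.fst_mem_support_of_mem_edges he) (not_mem_support_of_below hroot hw h.isBelow)
  · exact (h.kid hinj h' hk).2.2
  · exact (h'.kid hinj h hk).2.2.symm

/-- Two children of a vertex that have the same code can be cancelled, if there are no such pairs
further down. -/
theorem exists_cancelsAt (hroot : ∀ c ∈ C.support, T.depth c = 0) {v w w' : V}
    (hw : T.Kid H w v) (hw' : T.Kid H w' v) (hne : w ≠ w') (hcode : T.code H w = T.code H w')
    (hinj : ∀ x, T.Below H x w → KidsInj T H x) (hinj' : ∀ x, T.Below H x w' → KidsInj T H x) :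
    ∃ K, CancelsAt H v K := by
  choose f hf using fun x : {x | T.Below H x w} => Match.exists_of_below hcode hinj x.2
  choose g hg using fun x : {x | T.Below H x w'} => Match.exists_of_below hcode.symm hinj' x.2
  let e : {x | T.Below H x w} ≃ {x | T.Below H x w'} :=
    { toFun := fun x => ⟨f x, (hf x).symm.isBelow⟩
      invFun := fun x => ⟨g x, (hg x).symm.isBelow⟩
      left_inv := fun x => Subtype.ext ((hg ⟨f x, (hf x).symm.isBelow⟩).unique hinj (hf x).symm)
      right_inv := fun x => Subtype.ext ((hf ⟨g x, (hg x).symm.isBelow⟩).unique hinj' (hg x).symm) }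
  have hexit : ∀ z, T.Kid H z v → ∀ x ∈ {x | T.Below H x z}, ∀ y ∉ {x | T.Below H x z},
      H.Adj x y → x = z ∧ y = v := by
    intro z hz x hx y hy ha
    rcases mem_edges_or_kid (C := C) (T := T) ha with he | hk | hk
    · exact absurd (C.fst_mem_support_of_mem_edges he) (not_mem_support_of_below hroot hz hx)
    · exact absurd (Relation.ReflTransGen.head hk hx) hy
    · rcases RootedForest.Below.eq_or_kid hx with rfl | ⟨y', hy', hb⟩
      · exact ⟨rfl, hk.unique hz⟩
      · cases hk.unique hy'
        exact absurd hb hy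
  have hv : ∀ z, T.Kid H z v → ¬ T.Below H v z := fun z hz hb => by
    have := hz.depth_eq
    have := hb.depth_le
    omega
  refine ⟨_, {x | T.Below H x w}, {x | T.Below H x w'}, ⟨w, .refl⟩, ⟨w', .refl⟩,
    fun x hx => hx.mem_verts hw.2.2.snd_mem, fun x hx => hx.mem_verts hw'.2.2.snd_mem, ?_,
    hw.2.2.fst_mem, hv w hw, hv w' hw', hw.2.2, hw'.2.2, hexit w hw, hexit w' hw', ⟨e, ?_, ?_⟩, rfl⟩
  · rw [Set.disjoint_left]
    exact fun x hx hx' => hne (RootedForest.Below.kid_unique hw hw' hx hx')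
  · exact Subtype.ext ((hf ⟨w, .refl⟩).unique hinj' .base)
  · intro x y
    exact ⟨fun h => (hf x).symm.adj hroot hw' hinj (hf y).symm h,
      fun h => (hf x).adj hroot hw hinj' (hf y) h⟩

/-- Two siblings of equal code could be cancelled if there are no such pairs below them; so
induction starts at the leaves. -/
theorem kidsInj_of_isReduced (hroot : ∀ c ∈ C.support, T.depth c = 0) (hred : IsReduced H) (v : V) :
    KidsInj T H v := by
  suffices h : ∀ x, T.Below H x v → KidsInj T H x from h v .refl
  induction v using T.kid_induction H with
  | h v ih =>
    intro x hx
    rcases Relation.ReflTransGen.cases_tail hx with rfl | ⟨w, hb, hw⟩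
    · intro a b ha hb hab
      by_contra hne
      obtain ⟨K, hK⟩ := exists_cancelsAt hroot ha hb hne hab (ih a ha) (ih b hb)
      exact hred ⟨_, K, hK⟩
    · exact ih w hw x hb

theorem code_eq_zero_iff_of_isReduced (hroot : ∀ c ∈ C.support, T.depth c = 0)
    (hred : IsReduced H) {v : V} : T.code H v = 0 ↔ ∀ w, ¬ T.Kid H w v := by
  constructor
  · intro h w hw
    have := (kidsInj_of_isReduced hroot hred v).apply_code_ne_zero hw
    rw [h] at this
    exact this rfl
  · intro h
    rw [RootedForest.code_eq]
    exact Finset.sum_eq_zero fun w hw => absurd (RootedForest.mem_kids.1 hw) (h w)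

end Reduced

/-! ### Cancellation preserves the codes on the cycle -/

section Cancel

theorem mem_of_walk {S : Set V} {a b : V} (p : G.Walk a b) (ha : a ∈ S)
    (h : ∀ x ∈ S, ∀ y ∉ S, s(x, y) ∉ p.edges) : ∀ z ∈ p.support, z ∈ S := by
  induction p with
  | nil => simpa using ha
  | @cons a x b hadj p ih =>
    have hx : x ∈ S := by
      by_contra hx
      exact h a ha x hx (by simp)
    intro z hz
    rw [SimpleGraph.Walk.support_cons, List.mem_cons] at hz
    rcases hz with rfl | hz
    · exact ha
    · exact ih hx (fun x hx y hy he => h x hx y hy (by simp [he])) z hz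

variable {u : V} {C : G.Walk u u} {H : G.Subgraph}
  {T : RootedForest (G.deleteEdges {e | e ∈ C.edges})}

/-- The cycle does not meet a part that is cancelled. -/
theorem disjoint_of_cancel (hC : C.IsCycle)
    (hone : ∀ (w : V) (D : G.Walk w w), D.IsCycle → D.toSubgraph = C.toSubgraph)
    (hH : C.toSubgraph ≤ H) {S S' : Set V} {s v : V} (hS : Disjoint S S') (hv : v ∈ S) (hs : s ∉ S)
    (hexit : ∀ x ∈ S, ∀ y ∉ S, H.Adj x y → x = v ∧ y = s) (f : S ≃ S')
    (hf : ∀ x y : S, H.Adj (f x) (f y) ↔ H.Adj x y) : ∀ c ∈ C.support, c ∉ S := by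
  classical
  intro c hc hcS
  have hCH : ∀ e ∈ C.edges, e ∈ H.spanningCoe.edgeSet := fun e he => by
    rw [SimpleGraph.Subgraph.edgeSet_spanningCoe]
    exact SimpleGraph.Subgraph.edgeSet_mono hH (C.mem_edges_toSubgraph.2 he)
  -- This edge is the only way out of `S`, hence a bridge.
  have hnot : s(v, s) ∉ C.edges := by
    intro he
    obtain ⟨-, ⟨p⟩⟩ := SimpleGraph.adj_and_reachable_delete_edges_iff_exists_cycle.2
      ⟨u, C.transfer _ hCH, hC.transfer hCH, by rwa [SimpleGraph.Walk.edges_transfer]⟩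
    refine hs (mem_of_walk p hv (fun x hx y hy he => ?_) s p.end_mem_support)
    have h := p.adj_of_mem_edges he
    rw [SimpleGraph.deleteEdges_adj] at h
    obtain ⟨rfl, rfl⟩ := hexit x hx y hy h.1
    exact h.2 rfl
  have hall : ∀ z ∈ C.support, z ∈ S := fun z hz => by
    refine mem_of_walk (C.rotate c hc) hcS (fun x hx y hy he => ?_) z
      ((C.mem_support_rotate_iff c hc).2 hz)
    rw [(C.rotate_edges c hc).mem_iff] at he
    obtain ⟨rfl, rfl⟩ := hexit x hx y hy (hCH _ he)
    exact hnot he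
  have hall' : ∀ z ∈ (C.transfer _ hCH).support, z ∈ S := by
    rwa [SimpleGraph.Walk.support_transfer]
  -- A cycle inside `S` has an image under `f` inside `S'`, a second cycle.
  have hcyc : ((C.transfer _ hCH).induce S hall').IsCycle := by
    rw [← SimpleGraph.Walk.isCycle_map_iff_of_injective
      (f := (SimpleGraph.Embedding.induce (G := H.spanningCoe) S).toHom)
      (SimpleGraph.Embedding.induce (G := H.spanningCoe) S).injective,
      SimpleGraph.Walk.map_induce]
    exact hC.transfer hCH
  let g : H.spanningCoe.induce S →g G :=
    { toFun := fun x => (f x : V)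
      map_rel' := fun {x y} h => H.adj_sub ((hf x y).2 h) }
  have hg : Function.Injective g := fun x y h => f.injective (Subtype.ext h)
  have h1 := hone _ _ (hcyc.map hg)
  have h2 : g ⟨u, hall u C.start_mem_support⟩ ∈ C.support := by
    rw [← SimpleGraph.Walk.mem_verts_toSubgraph, ← h1, SimpleGraph.Walk.mem_verts_toSubgraph]
    exact SimpleGraph.Walk.start_mem_support _
  exact Set.disjoint_left.1 hS (hall _ h2) (f _).2

/-- A path upwards that leaves `S` does so through `v` and `s`. -/
theorem kid_of_below_of_exit {S : Set V} {s v : V}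
    (hexit : ∀ x ∈ S, ∀ y ∉ S, H.Adj x y → x = v ∧ y = s) {x c : V} (h : T.Below H x c)
    (hx : x ∈ S) (hc : c ∉ S) : T.Kid H v s := by
  induction h using Relation.ReflTransGen.head_induction_on with
  | refl => exact absurd hx hc
  | @head a b hk _ ih =>
    by_cases hb : b ∈ S
    · exact ih hb
    · obtain ⟨rfl, rfl⟩ := hexit a hx b hb hk.2.2.symm
      exact hk

theorem kid_of_cancel (hroot : ∀ c ∈ C.support, T.depth c = 0) {S : Set V} {s v c : V}
    (hCS : ∀ c ∈ C.support, c ∉ S) (hv : v ∈ S) (hadj : H.Adj s v)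
    (hexit : ∀ x ∈ S, ∀ y ∉ S, H.Adj x y → x = v ∧ y = s) (hc : c ∈ C.support)
    (hsc : T.Below H s c) : T.Kid H v s := by
  rcases mem_edges_or_kid (C := C) (T := T) hadj with he | hk | hk
  · exact absurd hv (hCS _ (C.snd_mem_support_of_mem_edges he))
  · exact hk
  · obtain ⟨w, hw, hb⟩ := hsc.eq_or_kid.resolve_left fun e =>
      not_kid_of_mem_support hroot hc (e ▸ hk)
    cases hw.unique hk
    exact kid_of_below_of_exit hexit hb hv (hCS c hc)

variable [Fintype V]

/-- The isomorphism of the cancelled parts preserves codes. -/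
theorem code_eq_of_cancel {S S' : Set V} {s v v' : V}
    (hCS : ∀ c ∈ C.support, c ∉ S) (hCS' : ∀ c ∈ C.support, c ∉ S') (hs : s ∉ S) (hs' : s ∉ S')
    (hv : T.Kid H v s) (hv' : T.Kid H v' s)
    (hexit : ∀ x ∈ S, ∀ y ∉ S, H.Adj x y → x = v ∧ y = s)
    (hexit' : ∀ x ∈ S', ∀ y ∉ S', H.Adj x y → x = v' ∧ y = s)
    (f : S ≃ S') (hf : ∀ x y : S, H.Adj (f x) (f y) ↔ H.Adj x y)
    (hvS : v ∈ S) (hfv : (f ⟨v, hvS⟩ : V) = v') : T.code H v = T.code H v' := by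
  -- The isomorphism knows nothing of roots. Once the parents of `x` and `f x` correspond, their
  -- other neighbours in the two parts are children.
  have hkid : ∀ x : S, ((x : V) = v ∨ ∃ p : S, T.Kid H x p ∧ T.Kid H (f x) (f p)) →
      ∀ y : S, T.Kid H y x ↔ T.Kid H (f y) (f x) := by
    intro x hx y
    constructor
    · intro hk
      have ha := (hf x y).2 hk.2.2
      rcases mem_edges_or_kid (C := C) (T := T) ha with he | hk' | hk'
      · exact absurd (f x).2 (hCS' _ (C.fst_mem_support_of_mem_edges he))
      · exact hk'
      · rcases hx with hx | ⟨p, hp, hfp⟩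
        · have hfx : (f x : V) = v' := by
            rw [← hfv]; congr 2; exact Subtype.ext hx
          rw [hfx] at hk'
          exact absurd (hk'.unique hv' ▸ (f y).2) hs'
        · cases f.injective (Subtype.ext (hk'.unique hfp))
          exact absurd hp hk.not_symm
    · intro hk
      have ha := (hf x y).1 hk.2.2
      rcases mem_edges_or_kid (C := C) (T := T) ha with he | hk' | hk'
      · exact absurd x.2 (hCS _ (C.fst_mem_support_of_mem_edges he))
      · exact hk'
      · rcases hx with hx | ⟨p, hp, hfp⟩
        · rw [hx] at hk'
          exact absurd (hk'.unique hv ▸ y.2) hs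
        · cases Subtype.ext (hk'.unique hp)
          exact absurd hfp hk.not_symm
  have key : ∀ x (hx : x ∈ S), (x = v ∨ ∃ p : S, T.Kid H x p ∧ T.Kid H (f ⟨x, hx⟩) (f p)) →
      T.code H x = T.code H (f ⟨x, hx⟩) := by
    intro x
    induction x using T.kid_induction H with
    | h x ih =>
      intro hx hp
      have hmem : ∀ y, T.Kid H y x → y ∈ S := by
        intro y hy
        by_contra hyS
        obtain ⟨rfl, rfl⟩ := hexit x hx y hyS hy.2.2
        exact hy.not_symm hv
      have hmem' : ∀ y, T.Kid H y (f ⟨x, hx⟩) → y ∈ S' := by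
        intro y hy
        by_contra hyS
        obtain ⟨h1, rfl⟩ := hexit' _ (f ⟨x, hx⟩).2 y hyS hy.2.2
        rw [h1] at hy
        exact hy.not_symm hv'
      rw [RootedForest.code_eq, RootedForest.code_eq (f ⟨x, hx⟩ : V)]
      refine Finset.sum_bij (fun y hy => (f ⟨y, hmem y (RootedForest.mem_kids.1 hy)⟩ : V))
        ?_ ?_ ?_ ?_
      · intro y hy
        have hy' := RootedForest.mem_kids.1 hy
        exact RootedForest.mem_kids.2 ((hkid ⟨x, hx⟩ hp ⟨y, hmem y hy'⟩).1 hy')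
      · intro y hy z hz h
        exact congrArg Subtype.val (f.injective (Subtype.ext h))
      · intro z hz
        have hz' := RootedForest.mem_kids.1 hz
        have hfz : f (f.symm ⟨z, hmem' z hz'⟩) = ⟨z, hmem' z hz'⟩ := f.apply_symm_apply _
        refine ⟨f.symm ⟨z, hmem' z hz'⟩, RootedForest.mem_kids.2
          ((hkid ⟨x, hx⟩ hp _).2 (by rw [hfz]; exact hz')), ?_⟩
        exact congrArg Subtype.val hfz
      · intro y hy
        have hy' := RootedForest.mem_kids.1 hy
        rw [ih y hy' (hmem y hy')
          (.inr ⟨⟨x, hx⟩, hy', (hkid ⟨x, hx⟩ hp ⟨y, hmem y hy'⟩).1 hy'⟩)]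
  rw [key v hvS (.inl rfl), hfv]

theorem code_of_cancelsAt (hC : C.IsCycle)
    (hone : ∀ (w : V) (D : G.Walk w w), D.IsCycle → D.toSubgraph = C.toSubgraph)
    (hroot : ∀ c ∈ C.support, T.depth c = 0) (hH : C.toSubgraph ≤ H) {s : V} {K : G.Subgraph}
    (h : CancelsAt H s K) :
    C.toSubgraph ≤ K ∧ ∀ c ∈ C.support, T.code K c = T.code H c := by
  classical
  obtain ⟨S, S', ⟨v, hvS⟩, ⟨v', hvS'⟩, -, -, hdisj, -, hs, hs', hadj, hadj', hexit, hexit', hiso,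
    rfl⟩ := h
  obtain ⟨f, hfv, hf⟩ := hiso
  have hCS := disjoint_of_cancel hC hone hH hdisj hvS hs hexit f hf
  have hCS' := disjoint_of_cancel hC hone hH hdisj.symm hvS' hs' hexit' f.symm fun x y => by
    rw [← hf, f.apply_symm_apply, f.apply_symm_apply]
  refine ⟨(toSubgraph_le_deleteVerts_iff hH _).2 fun c hc h => h.elim (hCS c hc) (hCS' c hc), ?_⟩
  -- Only below the cycle must the cancelled parts hang from `s`; elsewhere the rooting may put `s`
  -- under one of them.
  have key : ∀ x, x ∉ S ∪ S' → (∃ c ∈ C.support, T.Below H x c) →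
      T.code (H.deleteVerts (S ∪ S')) x = T.code H x := by
    intro x
    induction x using T.kid_induction H with
    | h x ih =>
      intro hx ⟨c, hc, hxc⟩
      have hkids : T.kids (H.deleteVerts (S ∪ S')) x =
          (T.kids H x).filter fun w => w ∉ S ∪ S' := by
        ext w
        simp only [RootedForest.mem_kids, RootedForest.kid_deleteVerts, Finset.mem_filter]
        tauto
      have hzero : ∑ w ∈ (T.kids H x).filter (fun w => ¬ w ∉ S ∪ S'), sing (T.code H w) = 0 := by
        by_cases hxs : x = s
        · subst hxs
          have hk := kid_of_cancel hroot hCS hvS hadj hexit hc hxc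
          have hk' := kid_of_cancel hroot hCS' hvS' hadj' hexit' hc hxc
          have hne : v ≠ v' := by
            rintro rfl; exact Set.disjoint_left.1 hdisj hvS hvS'
          have hset : (T.kids H x).filter (fun w => ¬ w ∉ S ∪ S') = {v, v'} := by
            ext w
            simp only [RootedForest.mem_kids, Finset.mem_filter, not_not, Finset.mem_insert,
              Finset.mem_singleton]
            constructor
            · rintro ⟨hw, hw' | hw'⟩
              · exact .inl (hexit w hw' x hs hw.2.2.symm).1
              · exact .inr (hexit' w hw' x hs' hw.2.2.symm).1
            · rintro (rfl | rfl)
              · exact ⟨hk, .inl hvS⟩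
              · exact ⟨hk', .inr hvS'⟩
          rw [hset, Finset.sum_pair hne, code_eq_of_cancel hCS hCS' hs hs' hk hk' hexit hexit' f hf
            hvS (congrArg Subtype.val hfv), Code.add_self]
        · refine Finset.sum_eq_zero fun w hw => ?_
          rw [Finset.mem_filter, RootedForest.mem_kids, not_not] at hw
          rw [Set.mem_union, not_or] at hx
          rcases hw.2 with h | h
          · exact absurd (hexit w h x hx.1 hw.1.2.2.symm).2 hxs
          · exact absurd (hexit' w h x hx.2 hw.1.2.2.symm).2 hxs
      rw [RootedForest.code_eq, hkids, RootedForest.code_eq x,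
        ← Finset.sum_filter_add_sum_filter_not (T.kids H x) (fun w => w ∉ S ∪ S'), hzero, add_zero]
      refine Finset.sum_congr rfl fun w hw => ?_
      rw [Finset.mem_filter, RootedForest.mem_kids] at hw
      rw [ih w hw.1 hw.2 ⟨c, hc, .head hw.1 hxc⟩]
  exact fun c hc => key c (fun h => h.elim (hCS c hc) (hCS' c hc)) ⟨c, hc, .refl⟩

theorem code_of_reducesTo (hC : C.IsCycle)
    (hone : ∀ (w : V) (D : G.Walk w w), D.IsCycle → D.toSubgraph = C.toSubgraph)
    (hroot : ∀ c ∈ C.support, T.depth c = 0) (hH : C.toSubgraph ≤ H) {K : G.Subgraph}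
    (h : ReducesTo H K) : C.toSubgraph ≤ K ∧ ∀ c ∈ C.support, T.code K c = T.code H c := by
  obtain ⟨h, -⟩ := h
  induction h with
  | refl => exact ⟨hH, fun _ _ => rfl⟩
  | tail _ h ih =>
    obtain ⟨s, hs⟩ := h
    obtain ⟨h1, h2⟩ := code_of_cancelsAt hC hone hroot ih.1 hs
    exact ⟨h1, fun c hc => (h2 c hc).trans (ih.2 c hc)⟩

end Cancel

theorem CancelsAt.lt {H K : G.Subgraph} {s : V} (h : CancelsAt H s K) : K < H := by
  obtain ⟨S, S', v, v', hS, -, -, -, -, -, -, -, -, -, -, rfl⟩ := h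
  refine lt_of_le_of_ne SimpleGraph.Subgraph.deleteVerts_le fun h => ?_
  have : (v : V) ∈ (H.deleteVerts (S ∪ S')).verts := by rw [h]; exact hS v.2
  rw [SimpleGraph.Subgraph.deleteVerts_verts] at this
  exact this.2 (.inl v.2)

theorem exists_reducesTo [Finite V] (H : G.Subgraph) : ∃ K, ReducesTo H K := by
  induction H using (wellFounded_lt (α := G.Subgraph)).induction with
  | _ H ih =>
    by_cases h : IsReduced H
    · exact ⟨H, .refl, h⟩
    · obtain ⟨s, K, hK⟩ := not_not.1 h
      obtain ⟨L, hL, hL'⟩ := ih K hK.lt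
      exact ⟨L, .head ⟨s, hK⟩ hL, hL'⟩

theorem ReducesTo.le {H K : G.Subgraph} (h : ReducesTo H K) : K ≤ H := by
  obtain ⟨h, -⟩ := h
  induction h with
  | refl => exact le_rfl
  | tail _ h ih =>
    obtain ⟨s, hs⟩ := h
    exact hs.lt.le.trans ih

/-! ### Telescoping vertices -/

section Telescoping

variable {u : V} {C : G.Walk u u} {T : RootedForest (G.deleteEdges {e | e ∈ C.edges})}

/-- Every vertex that is connected to the cycle lies below a vertex of the cycle. -/
theorem exists_below_of_reachable (hroot : ∀ c ∈ C.support, T.depth c = 0) {K : G.Subgraph}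
    {c v : V} (hc : c ∈ C.support) (h : K.spanningCoe.Reachable c v) :
    ∃ d ∈ C.support, T.Below K v d := by
  obtain ⟨p⟩ := h
  suffices ∀ a b (p : K.spanningCoe.Walk a b), (∃ d ∈ C.support, T.Below K a d) →
      ∃ d ∈ C.support, T.Below K b d from this c v p ⟨c, hc, .refl⟩
  intro a b p
  induction p with
  | nil => exact id
  | cons hadj p ih =>
    rintro ⟨d, hd, hb⟩
    refine ih ?_
    rcases mem_edges_or_kid (C := C) (T := T) (H := K) hadj with he | hk | hk
    · exact ⟨_, C.snd_mem_support_of_mem_edges he, .refl⟩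
    · exact ⟨d, hd, .head hk hb⟩
    · rcases hb.eq_or_kid with rfl | ⟨w, hw, hb⟩
      · exact absurd hk (not_kid_of_mem_support hroot hd)
      · cases hw.unique hk
        exact ⟨d, hd, hb⟩

variable [Fintype V]

/-- Reduction preserves the code at `A`, and in the reduced result this code is zero exactly when
`A` has no children; hence the choice of cancellations is immaterial. -/
theorem isTelescoping_iff (hC : C.IsCycle)
    (hone : ∀ (w : V) (D : G.Walk w w), D.IsCycle → D.toSubgraph = C.toSubgraph)
    (hroot : ∀ c ∈ C.support, T.depth c = 0) {A t : V} (hA : A ∈ C.support) :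
    IsTelescoping C A t ↔ t ∈ attachedTree C A ∧ t ∉ C.support ∧
      T.code ((⊤ : G.Subgraph).deleteVerts {t}) A = 0 := by
  have hiff : ∀ K : G.Subgraph, C.toSubgraph ≤ K → IsReduced K →
      ({v | v ∈ attachedTree C A ∧ v ∈ K.verts ∧ ∃ c ∈ C.support, K.spanningCoe.Reachable c v} = {A}
        ↔ T.code K A = 0) := by
    intro K hK hred
    rw [code_eq_zero_iff_of_isReduced hroot hred]
    constructor
    · intro h w hw
      have : w ∈ ({A} : Set V) := by
        rw [← h]
        exact ⟨hw.adj.reachable, hw.2.2.snd_mem, A, hA,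
          SimpleGraph.Adj.reachable (G := K.spanningCoe) hw.2.2⟩
      rw [Set.mem_singleton_iff] at this
      exact hw.2.2.ne this.symm
    · intro h
      ext v
      rw [Set.mem_singleton_iff]
      constructor
      · rintro ⟨hv, -, c, hc, hcv⟩
        obtain ⟨d, hd, hb⟩ := exists_below_of_reachable (T := T) hroot hc hcv
        have hv : (G.deleteEdges {e | e ∈ C.edges}).Reachable A v := hv
        cases eq_of_reachable_deleteEdges hC hone hA hd (hv.trans hb.reachable.symm)
        rcases Relation.ReflTransGen.cases_tail hb with h' | ⟨w, _, hw⟩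
        · exact h'.symm
        · exact absurd hw (h w)
      · rintro rfl
        exact ⟨SimpleGraph.Reachable.refl _, mem_verts_of_mem_support hK hA, v, hA,
          SimpleGraph.Reachable.refl _⟩
  constructor
  · rintro ⟨ht, K, hK, hset⟩
    have htC : t ∉ C.support := by
      intro htC
      cases eq_of_reachable_deleteEdges hC hone hA htC ht
      have : A ∈ ({A} : Set V) := rfl
      rw [← hset] at this
      have := hK.le.1 this.2.1
      rw [SimpleGraph.Subgraph.deleteVerts_verts] at this
      exact this.2 rfl
    obtain ⟨h1, h2⟩ := code_of_reducesTo hC hone hroot (toSubgraph_le_deleteVerts le_top htC) hK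
    exact ⟨ht, htC, by rw [← h2 A hA]; exact (hiff K h1 hK.2).1 hset⟩
  · rintro ⟨ht, htC, h0⟩
    obtain ⟨K, hK⟩ := exists_reducesTo ((⊤ : G.Subgraph).deleteVerts {t})
    obtain ⟨h1, h2⟩ := code_of_reducesTo hC hone hroot (toSubgraph_le_deleteVerts le_top htC) hK
    exact ⟨ht, K, hK, (hiff K h1 hK.2).2 (by rw [h2 A hA]; exact h0)⟩

theorem deg_top [DecidableRel G.Adj] (v : V) : deg (⊤ : G.Subgraph) v = G.degree v := by
  rw [deg, ← SimpleGraph.card_neighborFinset_eq_degree, ← Set.ncard_coe_finset]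
  congr 1
  ext w
  simp

theorem degree_eq_two_iff [DecidableRel G.Adj] (hC : C.IsCycle)
    (hroot : ∀ c ∈ C.support, T.depth c = 0) (hred : IsReduced (⊤ : G.Subgraph)) {c : V}
    (hc : c ∈ C.support) : G.degree c = 2 ↔ T.code (⊤ : G.Subgraph) c = 0 := by
  rw [code_eq_zero_iff_of_isReduced hroot hred, ← deg_top,
    deg_of_mem_support (T := T) hC hroot le_top hc, add_eq_left, Finset.card_eq_zero,
    Finset.eq_empty_iff_forall_notMem]
  simp only [RootedForest.mem_kids]

theorem two_lt_degree_iff [DecidableRel G.Adj] (hC : C.IsCycle)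
    (hroot : ∀ c ∈ C.support, T.depth c = 0) (hred : IsReduced (⊤ : G.Subgraph)) {c : V}
    (hc : c ∈ C.support) : 2 < G.degree c ↔ T.code (⊤ : G.Subgraph) c ≠ 0 := by
  rw [Ne, ← degree_eq_two_iff hC hroot hred hc, ← deg_top,
    deg_of_mem_support (T := T) hC hroot le_top hc]
  omega

theorem oneBad_top_iff [DecidableRel G.Adj] (hC : C.IsCycle)
    (hone : ∀ (w : V) (D : G.Walk w w), D.IsCycle → D.toSubgraph = C.toSubgraph)
    (hroot : ∀ c ∈ C.support, T.depth c = 0) (hred : IsReduced (⊤ : G.Subgraph)) :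
    OneBad T (⊤ : G.Subgraph) ↔
      ∃ A ∈ C.support, 2 < G.degree A ∧ (∀ B ∈ C.support, 2 < G.degree B → B = A) ∧
        ∃ t : V, IsTelescoping C A t ∧ Odd (G.degree t) := by
  constructor
  · rintro ⟨A, hA, hb, hz⟩
    refine ⟨A, hA, (two_lt_degree_iff hC hroot hred hA).2 hb.ne_zero, fun B hB h => ?_, ?_⟩
    · by_contra hne
      exact (two_lt_degree_iff hC hroot hred hB).1 h (hz B hB hne)
    · obtain ⟨t, -, htC, hd, hbel, hne, hcode⟩ :=
        exists_odd_deg_of_mv hroot (mem_verts_of_mem_support le_top hA) hb.mv_self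
      rw [Code.add_self] at hcode
      exact ⟨t, (isTelescoping_iff hC hone hroot hA).2 ⟨hbel.reachable, htC, hcode⟩,
        by rwa [← deg_top]⟩
  · rintro ⟨A, hA, hdeg, huniq, t, ht, hodd⟩
    obtain ⟨-, htC, hcode⟩ := (isTelescoping_iff hC hone hroot hA).1 ht
    have hA0 := (two_lt_degree_iff hC hroot hred hA).1 hdeg
    rw [← deg_top] at hodd
    -- The code at `A` drops to zero, so the change is the code itself.
    obtain ⟨hb, -⟩ := exists_change (H := ⊤) hroot htC hodd hA (by rw [hcode]; exact hA0.symm)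
    rw [hcode, add_zero] at hb
    refine ⟨A, hA, hb, fun c hc hne => ?_⟩
    by_contra h0
    exact hne (huniq c hc ((two_lt_degree_iff hC hroot hred hc).2 h0))

end Telescoping

end GraphTakeaway

/-! ### The criterion for reduced graphs -/

theorem corollary5p3 {V : Type*} [Fintype V] (G : SimpleGraph V) [DecidableRel G.Adj]
    {u : V} (C : G.Walk u u) (hC : C.IsCycle) (hodd : Odd C.length)
    (hone : ∀ (w : V) (D : G.Walk w w), D.IsCycle → D.toSubgraph = C.toSubgraph)
    (hred : GraphTakeaway.IsReduced (⊤ : G.Subgraph)) :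
    GraphTakeaway.nimValue (⊤ : G.Subgraph) ≠ GraphTakeaway.phi (⊤ : G.Subgraph) ↔
      (∀ v ∈ C.support, G.degree v = 2) ∨
      (∃ A ∈ C.support, 2 < G.degree A ∧ (∀ B ∈ C.support, 2 < G.degree B → B = A) ∧
        ∃ t : V, GraphTakeaway.IsTelescoping C A t ∧ Odd (G.degree t)) := by
  obtain ⟨T, hroot⟩ := GraphTakeaway.exists_rootedForest_of_cycle hC hone
  rw [GraphTakeaway.nimValue_ne_phi_iff hC hodd hone hroot le_top,
    GraphTakeaway.oneBad_top_iff hC hone hroot hred]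
  refine or_congr_left (forall₂_congr fun c hc => ?_)
  exact (GraphTakeaway.degree_eq_two_iff hC hroot hred hc).symm
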